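/- A polynomial $f(x)\in\mathbb{R}[x]$ is called $\gamma$-positive if there are $n\in\mathbb{N}$ and nonnegative reals $\gamma_0,\dots,\gamma_{\lfloor n/2\rfloor}$ with $f(x)=\sum_{i=0}^{\lfloor n/2\rfloor}\gamma_i x^i(1+x)^{n-2i}$. All simplicial complexes are finite and contain the empty face. For a simplicial complex $\Gamma$ of dimension $d-1$ with $f_{i-1}(\Gamma)$ faces of cardinality $i$, put $h(\Gamma,x)=\sum_{i=0}^{d} f_{i-1}(\Gamma)\,x^i(1-x)^{d-i}$. A triangulation of a simplicial complex $\Delta$, given in a geometric realization, is a finite geometric simplicial complex $\Delta'$ with the same underlying space such that every simplex of $\Delta'$ is contained in a simplex of $\Delta$. For a face $F$ of $\Delta$, $\Delta'_F$ denotes the subcomplex of all simplices of $\Delta'$ contained in $F$, and the local $h$-polynomial is $$\ell_F(\Delta'_F,x)=\sum_{G\subseteq F}(-1)^{|F|-|G|}\,h(\Delta'_G,x),$$ where faces are identified with their vertex sets. **Corollary.** Suppose that $\Delta$ is either * the simplicial join $\Sigma_n$ of $n\ge 0$ copies of the zero-dimensional sphere (equivalently, the boundary complex of the $n$-dimensional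 cross-polytope), or * the barycentric subdivision of the boundary complex of an $n$-dimensional simplex, for some $n\ge 0$. Then $h(\Delta',x)$ is $\gamma$-positive for every triangulation $\Delta'$ of $\Delta$ for which $\ell_F(\Delta'_F,x)$ is $\gamma$-positive for every face $F\in\Delta$. -/

import Mathlib

open Polynomial

noncomputable section

namespace GammaPos

/-- A real polynomial `f` is `γ`-positive if for some `n` it is a combination, with nonnegative
real coefficients, of the polynomials `x ^ i * (1 + x) ^ (n - 2 * i)`, `0 ≤ i ≤ ⌊n / 2⌋`. -/
def IsGammaPositive (f : ℝ[X]) : Prop :=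
  ∃ (n : ℕ) (γ : ℕ → ℝ), (∀ i, 0 ≤ γ i) ∧
    f = ∑ i ∈ Finset.range (n / 2 + 1), C (γ i) * X ^ i * (1 + X) ^ (n - 2 * i)

section Abstract

/-! Mathlib's (pre-)abstract simplicial complexes record the nonempty faces only. The empty
set is also regarded as a face, of cardinality `0`, in all the definitions below. -/

variable {α : Type*}

/-- The number of faces with `i` vertices, that is, of dimension `i - 1`. The empty face is the
unique face with `0` vertices. -/
def faceNumber (K : PreAbstractSimplicialComplex α) (i : ℕ) : ℕ :=
  if i = 0 then 1 else Set.ncard {s : Finset α | s ∈ K.faces ∧ s.card = i}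

/-- The dimension of a finite complex plus one: the largest number of vertices of a face
(it is `0` if the empty set is the only face). -/
def dimAddOne (K : PreAbstractSimplicialComplex α) : ℕ :=
  sSup (Finset.card '' K.faces)

/-- The `h`-polynomial of a finite simplicial complex. -/
def hPoly (K : PreAbstractSimplicialComplex α) : ℝ[X] :=
  ∑ i ∈ Finset.range (dimAddOne K + 1),
    (faceNumber K i : ℝ[X]) * X ^ i * (1 - X) ^ (dimAddOne K - i)

/-- The subcomplex of the faces all of whose vertices lie in `A`. -/
def restrict (K : PreAbstractSimplicialComplex α) (A : Set α) :
    PreAbstractSimplicialComplex α where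
  faces := {s | s ∈ K.faces ∧ (s : Set α) ⊆ A}
  isRelLowerSet_faces := by
    rintro s ⟨hs, hA⟩
    refine ⟨(K.isRelLowerSet_faces hs).1, fun t hts ht => ?_⟩
    exact ⟨(K.isRelLowerSet_faces hs).2 hts ht, fun x hx => hA (hts hx)⟩

/-- The boundary complex of the simplex `2 ^ V`: all (nonempty) proper subsets of `V`. -/
def simplexBoundary (V : Type*) [Fintype V] : PreAbstractSimplicialComplex V where
  faces := {s | s.Nonempty ∧ s ≠ Finset.univ}
  isRelLowerSet_faces := by
    rintro s ⟨hs, hne⟩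
    refine ⟨hs, fun t hts ht => ⟨ht, ?_⟩⟩
    rintro rfl
    exact hne (Finset.univ_subset_iff.mp hts)

/-- The simplicial join of a family of complexes: the vertex set is the disjoint union of the
vertex sets, and the faces are the finite sets that meet the vertex set of each member of the
family in a face (possibly the empty one) of that member. -/
def join {ι : Type*} {β : ι → Type*} (K : ∀ i, PreAbstractSimplicialComplex (β i)) :
    PreAbstractSimplicialComplex (Σ i, β i) where
  faces := {s | s.Nonempty ∧ ∀ i,
    s.preimage (Sigma.mk i) sigma_mk_injective.injOn = ∅ ∨
      s.preimage (Sigma.mk i) sigma_mk_injective.injOn ∈ (K i).faces}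
  isRelLowerSet_faces := by
    rintro s ⟨hs, h⟩
    refine ⟨hs, fun t hts ht => ⟨ht, fun i => ?_⟩⟩
    have hsub : t.preimage (Sigma.mk i) sigma_mk_injective.injOn ⊆
        s.preimage (Sigma.mk i) sigma_mk_injective.injOn := by
      intro x hx
      rw [Finset.mem_preimage] at hx ⊢
      exact hts hx
    rcases Finset.eq_empty_or_nonempty
      (t.preimage (Sigma.mk i) sigma_mk_injective.injOn) with h0 | h0
    · exact Or.inl h0
    · rcases h i with h1 | h1
      · rw [h1] at hsub
        exact Or.inl (Finset.subset_empty.mp hsub)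
      · exact Or.inr (((K i).isRelLowerSet_faces h1).2 hsub h0)

/-- `Σ_n`, the simplicial join of `n` copies of the zero-dimensional sphere, i.e. of the complex
consisting of two isolated vertices. It is the boundary complex of the `n`-dimensional
cross-polytope. -/
def crossPolytopeBoundary (n : ℕ) : PreAbstractSimplicialComplex (Σ _ : Fin n, Bool) :=
  join fun _ : Fin n => simplexBoundary Bool

/-- The barycentric subdivision: its vertices are the nonempty faces of `K` and its faces are
the chains of nonempty faces of `K`. -/
def barycentricSubdivision (K : PreAbstractSimplicialComplex α) :
    PreAbstractSimplicialComplex (Finset α) where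
  faces := {c | c.Nonempty ∧ (∀ s ∈ c, s ∈ K.faces) ∧
    IsChain (· ⊆ ·) (c : Set (Finset α))}
  isRelLowerSet_faces := by
    rintro c ⟨hc, hK, hch⟩
    refine ⟨hc, fun d hdc hd => ⟨hd, fun s hs => hK s (hdc hs), ?_⟩⟩
    exact hch.mono (Finset.coe_subset.mpr hdc)

end Abstract

section Geometric

variable {E : Type*} [AddCommGroup E] [Module ℝ E]

/-- The geometric complex `Δ` is a geometric realization of the abstract complex `K`: some map,
injective on the vertices of `K`, carries the faces of `K` onto the faces of `Δ`. -/
def IsRealization {α : Type*} (Δ : Geometry.SimplicialComplex ℝ E)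
    (K : PreAbstractSimplicialComplex α) : Prop :=
  ∃ φ : α → E, Set.InjOn φ {v | {v} ∈ K.faces} ∧
    ∀ s : Finset E, s ∈ Δ.faces ↔ ∃ t ∈ K.faces, (s : Set E) = φ '' (t : Set α)

/-- `Δ'` is a triangulation (a finite geometric simplicial subdivision) of `Δ`: both have the
same underlying space, and every simplex of `Δ'` is contained in a simplex of `Δ`. -/
def IsTriangulation (Δ' Δ : Geometry.SimplicialComplex ℝ E) : Prop :=
  Δ'.faces.Finite ∧ Δ'.space = Δ.space ∧
    ∀ s ∈ Δ'.faces, ∃ F ∈ Δ.faces,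
      convexHull ℝ (s : Set E) ⊆ convexHull ℝ (F : Set E)

/-- The restriction `Δ'_F` of `Δ'` to the simplex with vertex set `F`: the subcomplex of the
simplices of `Δ'` contained in the convex hull of `F` (only the empty face if `F = ∅`). -/
def faceRestriction (Δ' : Geometry.SimplicialComplex ℝ E) (F : Finset E) :
    PreAbstractSimplicialComplex E :=
  restrict Δ'.toPreAbstractSimplicialComplex (convexHull ℝ (F : Set E))

/-- The local `h`-polynomial `ℓ_F(Δ'_F, x)` of the restriction of `Δ'` to the simplex with vertex
set `F`: the sum over all `G ⊆ F` of `(-1) ^ (|F| - |G|) * h(Δ'_G, x)`. -/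
def localHPoly (Δ' : Geometry.SimplicialComplex ℝ E) (F : Finset E) : ℝ[X] :=
  ∑ G ∈ F.powerset, (-1) ^ (F.card - G.card) * hPoly (faceRestriction Δ' G)

end Geometric

end GammaPos

end

/-!
A triangulation `Δ'` of `Δ` assigns to each of its simplices a carrier, the smallest face of `Δ`
containing it. Sorting the simplices by carriers and applying Möbius inversion in Boolean lattices
gives Stanley's formula: `h(Δ', x)` is the sum over the faces `F` of `Δ` of the product of the local
`h`-polynomial at `F` with the `h`-polynomial of the link of `F`
(`sum_eq_sum_localPoly_mul_linkPoly`). Products of `γ`-positive polynomials are `γ`-positive, and so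
are sums of `γ`-positive polynomials with a common centre of symmetry. So two facts are needed.

* The local `h`-polynomial at `F` is palindromic with centre `|F| / 2`, so that the centre in the
  hypothesis of `γ`-positivity is the expected one (`IsGammaPositive.gammaCentered`). This follows
  from the reciprocity `x ^ |F| * h(Δ'_F, 1 / x) = h(int Δ'_F, x)`, where only the simplices with
  carrier `F` count on the right. Instead of computing Euler characteristics of links, one
  passes to the simplicial cone over `F`, subdivided by the cones over the simplices of `Δ'_F`,
  and chooses a generic vector `ξ` in its interior. A point in the relative interior of the
  cone over a simplex `s`, moved slightly in direction `ξ`, enters the interior of a unique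
  top-dimensional cone `t`, of which `s` is a face containing all generators at which `ξ` has a
  negative coordinate. Thus the simplices are partitioned into intervals, and `h(Δ'_F, x)`
  enumerates the `t` by the number of negative coordinates of `ξ`. Moving in direction `-ξ` instead,
  exactly the interior simplices stay in the cone, and their polynomial enumerates the `t` by the
  number of positive coordinates (`SubdividesCone.exists_hPoly_eq_sum`).

* The `h`-polynomials of the links in `Δ` are `γ`-positive with the right centre (`GammaLinks`). For
  the boundary of the cross-polytope they are powers of `1 + x` (`linkPoly_crossFaces`).
  For the barycentric subdivision of the boundary of a simplex, faces are chains of sets, the link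
  of a chain is a join over its gaps (`linkPoly_chains_mul`), and each gap contributes an Eulerian
  polynomial (`linkPoly_chains_eq_eulerianPoly`). The latter is `γ`-positive by its differential
  recurrence (`gammaCentered_eulerianPoly`), while the chains are counted by the binomial
  recurrence; the two are matched through the power series `∑ (j + 1) ^ m * x ^ j`.
-/

noncomputable section

namespace GammaPos

/-! ### Polynomials with nonnegative `γ`-vector and given centre of symmetry -/

/-- `γ`-positivity with centre of symmetry `n / 2`: `f` is a combination with nonnegative
coefficients of the polynomials `x ^ i * (1 + x) ^ (n - 2 * i)`. -/
def GammaCentered (n : ℕ) (f : ℝ[X]) : Prop :=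
  ∃ γ : ℕ → ℝ, (∀ i, 0 ≤ γ i) ∧
    f = ∑ i ∈ Finset.range (n / 2 + 1), C (γ i) * X ^ i * (1 + X) ^ (n - 2 * i)

namespace GammaCentered

variable {n m : ℕ} {f g : ℝ[X]}

lemma isGammaPositive (h : GammaCentered n f) : IsGammaPositive f := ⟨n, h⟩

lemma zero (n : ℕ) : GammaCentered n 0 := ⟨0, by simp, by simp⟩

lemma add (hf : GammaCentered n f) (hg : GammaCentered n g) : GammaCentered n (f + g) := by
  obtain ⟨a, ha, rfl⟩ := hf
  obtain ⟨b, hb, rfl⟩ := hg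
  refine ⟨a + b, fun i => add_nonneg (ha i) (hb i), ?_⟩
  simp [Finset.sum_add_distrib, add_mul]

lemma sum {ι : Type*} {s : Finset ι} {f : ι → ℝ[X]} (h : ∀ i ∈ s, GammaCentered n (f i)) :
    GammaCentered n (∑ i ∈ s, f i) :=
  Finset.sum_induction _ _ (fun _ _ => add) (zero n) h

lemma monomial {i : ℕ} (hi : 2 * i ≤ n) {c : ℝ} (hc : 0 ≤ c) :
    GammaCentered n (C c * X ^ i * (1 + X) ^ (n - 2 * i)) := by
  refine ⟨fun j => if j = i then c else 0, fun j => ?_, ?_⟩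
  · dsimp only
    split_ifs
    exacts [hc, le_rfl]
  · rw [Finset.sum_eq_single i]
    · simp
    · intro j _ hj
      simp [hj]
    · intro hn
      exact absurd (Finset.mem_range.mpr (by omega)) hn

lemma one_add_X_pow (n : ℕ) : GammaCentered n ((1 + X) ^ n) := by
  simpa using monomial (n := n) (i := 0) (by simp) zero_le_one

lemma mul (hf : GammaCentered n f) (hg : GammaCentered m g) : GammaCentered (n + m) (f * g) := by
  obtain ⟨a, ha, rfl⟩ := hf
  obtain ⟨b, hb, rfl⟩ := hg
  rw [Finset.sum_mul_sum]
  refine sum fun i hi => sum fun j hj => ?_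
  rw [Finset.mem_range] at hi hj
  have := monomial (n := n + m) (i := i + j) (by omega) (mul_nonneg (ha i) (hb j))
  rw [show n + m - 2 * (i + j) = (n - 2 * i) + (m - 2 * j) by omega, pow_add, pow_add,
    C_mul] at this
  convert this using 1
  ring

lemma eval_inv (h : GammaCentered n f) {x : ℝ} (hx : 0 < x) : x ^ n * f.eval x⁻¹ = f.eval x := by
  obtain ⟨a, -, rfl⟩ := h
  simp only [eval_finsetSum, Finset.mul_sum]
  refine Finset.sum_congr rfl fun i hi => ?_
  rw [Finset.mem_range] at hi
  obtain ⟨k, hk⟩ : ∃ k, n = 2 * i + k := ⟨n - 2 * i, by omega⟩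
  have h1 : (1 + x⁻¹) * x = 1 + x := by field_simp; ring
  have h2 : n - 2 * i = k := by omega
  rw [h2, hk]
  simp only [eval_mul, eval_C, eval_pow, eval_X, eval_add, eval_one]
  rw [← h1, mul_pow, two_mul, pow_add, pow_add, inv_pow]
  field_simp

end GammaCentered

/-- The centre of a nonzero `γ`-positive polynomial is determined by its functional equation. -/
lemma IsGammaPositive.gammaCentered {f : ℝ[X]} (h : IsGammaPositive f) {m : ℕ}
    (hm : ∀ x : ℝ, 0 < x → x ^ m * f.eval x⁻¹ = f.eval x) : GammaCentered m f := by
  obtain ⟨n, hn⟩ := h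
  by_cases h0 : f.eval 2 = 0
  · obtain ⟨a, ha, hf⟩ := hn
    have hz : f = 0 := by
      rw [hf, eval_finsetSum, Finset.sum_eq_zero_iff_of_nonneg] at h0
      · rw [hf]
        refine Finset.sum_eq_zero fun i hi => ?_
        have := h0 i hi
        have h3 : ((1 : ℝ) + 2) ≠ 0 := by norm_num
        simp only [eval_mul, eval_C, eval_pow, eval_X, eval_add, eval_one, mul_eq_zero,
          pow_eq_zero_iff', h3, false_and, or_false, two_ne_zero] at this
        simp [this]
      · intro i _
        have := ha i
        simp only [eval_mul, eval_C, eval_pow, eval_X, eval_add, eval_one]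
        positivity
    rw [hz]
    exact GammaCentered.zero m
  · have h1 := hm 2 two_pos
    have h2 := GammaCentered.eval_inv hn two_pos
    have h3 : f.eval (2 : ℝ)⁻¹ ≠ 0 := fun h => h0 (by rw [← h1, h, mul_zero])
    have h4 : (2 : ℝ) ^ m = 2 ^ n := mul_right_cancel₀ h3 (h1.trans h2.symm)
    rwa [pow_right_injective₀ two_pos (by norm_num) h4]

/-! ### Eulerian polynomials -/

/-- The Eulerian polynomial of degree `n`, enumerating the permutations of `n + 1` letters
by descents, defined by the differential recurrence. -/
def eulerianPoly : ℕ → ℝ[X]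
  | 0 => 1
  | n + 1 => (1 + (n + 1 : ℝ[X]) * X) * eulerianPoly n + X * (1 - X) * derivative (eulerianPoly n)

/-- The differential recurrence acts on the basis `x ^ i * (1 + x) ^ (n - 2 * i)` with
nonnegative coefficients. -/
lemma gammaCentered_eulerianPoly (n : ℕ) : GammaCentered n (eulerianPoly n) := by
  induction n with
  | zero => simpa [eulerianPoly] using GammaCentered.one_add_X_pow 0
  | succ n ih =>
    obtain ⟨a, ha, hf⟩ := ih
    rw [eulerianPoly, hf, derivative_sum, Finset.mul_sum, Finset.mul_sum, ← Finset.sum_add_distrib]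
    refine GammaCentered.sum fun i hi => ?_
    rw [Finset.mem_range] at hi
    obtain ⟨k, hk⟩ : ∃ k, n = 2 * i + k := ⟨n - 2 * i, by omega⟩
    have hki : n - 2 * i = k := by omega
    have h1 := GammaCentered.monomial (n := n + 1) (i := i) (by omega)
      (mul_nonneg (ha i) (by positivity : (0 : ℝ) ≤ i + 1))
    rw [show n + 1 - 2 * i = k + 1 by omega] at h1
    rw [hki]
    have hX : X * derivative (X ^ i : ℝ[X]) = (i : ℝ[X]) * X ^ i := by
      rcases i with _ | i
      · simp
      · rw [derivative_X_pow_succ, C_add, C_1, map_natCast]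
        push_cast
        ring
    rcases k with _ | k
    · convert h1 using 1
      have hn : (n : ℝ[X]) = 2 * i := by rw [hk]; push_cast; ring
      simp only [pow_zero, mul_one, derivative_C_mul, hn, C_mul, C_add, C_1, map_natCast]
      linear_combination C (a i) * (1 - X) * hX
    · have h2 := GammaCentered.monomial (n := n + 1) (i := i + 1) (by omega)
        (mul_nonneg (ha i) (by positivity : (0 : ℝ) ≤ 2 * (k + 1)))
      rw [show n + 1 - 2 * (i + 1) = k by omega] at h2
      convert h1.add h2 using 1
      have hn : (n : ℝ[X]) = 2 * i + k + 1 := by rw [hk]; push_cast; ring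
      have hd : derivative ((1 + X) ^ (k + 1) : ℝ[X]) = ((k : ℝ[X]) + 1) * (1 + X) ^ k := by
        rw [derivative_pow]; simp
      simp only [derivative_mul, derivative_C, zero_mul, zero_add, hn, hd, C_mul, C_add, C_1,
        map_natCast, map_ofNat]
      linear_combination C (a i) * (1 - X) * (1 + X) ^ (k + 1) * hX

/-- The power series `∑ (j + 1) ^ m * x ^ j`. -/
def powerSumSeries (m : ℕ) : PowerSeries ℝ := PowerSeries.mk fun j => ((j : ℝ) + 1) ^ m

lemma powerSumSeries_zero_mul : powerSumSeries 0 * (1 - PowerSeries.X) = 1 := by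
  have := PowerSeries.mk_one_mul_one_sub_eq_one ℝ
  have h1 : powerSumSeries 0 = PowerSeries.mk 1 := by
    ext j
    simp [powerSumSeries]
  rwa [h1]

lemma powerSumSeries_succ (m : ℕ) : powerSumSeries (m + 1) =
    powerSumSeries m + PowerSeries.X * PowerSeries.derivative ℝ (powerSumSeries m) := by
  ext j
  rcases j with _ | j
  · simp [powerSumSeries]
  · rw [map_add, PowerSeries.coeff_succ_X_mul, PowerSeries.coeff_derivative]
    simp only [powerSumSeries, PowerSeries.coeff_mk]
    push_cast
    ring

lemma powerSumSeries_binomial (m : ℕ) : powerSumSeries m =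
    powerSumSeries 0 + PowerSeries.X *
      ∑ k ∈ Finset.range m, (m.choose (k + 1) : PowerSeries ℝ) * powerSumSeries (k + 1) := by
  ext j
  have hc : ∀ (c : ℕ) (p : PowerSeries ℝ) (i : ℕ),
      PowerSeries.coeff i ((c : PowerSeries ℝ) * p) = c * PowerSeries.coeff i p := by
    intro c p i
    rw [← nsmul_eq_mul, map_nsmul, nsmul_eq_mul]
  rcases j with _ | j
  · simp [powerSumSeries]
  · rw [map_add, PowerSeries.coeff_succ_X_mul, map_sum]
    simp only [hc, powerSumSeries, PowerSeries.coeff_mk]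
    rw [add_pow, Finset.sum_range_succ']
    push_cast
    simp only [one_pow, mul_one, pow_zero, Nat.choose_zero_right, Nat.cast_one]
    rw [add_comm]
    congr 1
    exact Finset.sum_congr rfl fun k _ => mul_comm _ _

/-- Euler's identity `∑ (j + 1) ^ (n + 1) * x ^ j = A(x) / (1 - x) ^ (n + 2)`. -/
lemma coe_eulerianPoly (n : ℕ) : (eulerianPoly n : PowerSeries ℝ) =
    (1 - PowerSeries.X) ^ (n + 2) * powerSumSeries (n + 1) := by
  have hd1 : PowerSeries.derivative ℝ (1 - PowerSeries.X : PowerSeries ℝ) = -1 := by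
    simp
  induction n with
  | zero =>
    have h0 := powerSumSeries_zero_mul
    have hd := congrArg (PowerSeries.derivative ℝ) h0
    rw [Derivation.leibniz, hd1] at hd
    simp only [smul_eq_mul, Derivation.map_one_eq_zero] at hd
    rw [powerSumSeries_succ, eulerianPoly, Polynomial.coe_one]
    linear_combination (-1 : PowerSeries ℝ) * h0 - (1 - PowerSeries.X) * PowerSeries.X * hd
  | succ n ih =>
    have hD : ((derivative (eulerianPoly n) : ℝ[X]) : PowerSeries ℝ) =
        PowerSeries.derivative ℝ (eulerianPoly n : PowerSeries ℝ) :=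
      (PowerSeries.derivative_coe _).symm
    rw [eulerianPoly]
    simp only [Polynomial.coe_add, Polynomial.coe_mul, Polynomial.coe_one, Polynomial.coe_X,
      Polynomial.coe_sub, hD, ih]
    rw [Derivation.leibniz, Derivation.leibniz_pow, hd1, powerSumSeries_succ (n + 1)]
    have hn : ((n : ℝ[X]) : PowerSeries ℝ) = (n : PowerSeries ℝ) := by
      exact map_natCast (Polynomial.coeToPowerSeries.ringHom (R := ℝ)) n
    rw [hn]
    simp only [smul_eq_mul, nsmul_eq_mul]
    push_cast
    ring

/-- The binomial recurrence of the Eulerian polynomials. -/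
lemma eulerianPoly_binomial (n : ℕ) : eulerianPoly n = (1 - X) ^ n +
    X * ∑ k ∈ Finset.range n,
      ((n + 1).choose (k + 1) : ℝ[X]) * ((1 - X) ^ (n - 1 - k) * eulerianPoly k) := by
  have hne : (1 - PowerSeries.X : PowerSeries ℝ) ≠ 0 := by
    intro h
    have := congrArg (PowerSeries.coeff 0) h
    simp at this
  apply Polynomial.coe_injective
  apply mul_left_cancel₀ hne
  have hcast : ∀ c : ℕ, ((c : ℝ[X]) : PowerSeries ℝ) = (c : PowerSeries ℝ) := fun c =>
    map_natCast (Polynomial.coeToPowerSeries.ringHom (R := ℝ)) c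
  have hsum : ((∑ k ∈ Finset.range n, ((n + 1).choose (k + 1) : ℝ[X]) *
      ((1 - X) ^ (n - 1 - k) * eulerianPoly k) : ℝ[X]) : PowerSeries ℝ) =
      ∑ k ∈ Finset.range n, ((n + 1).choose (k + 1) : PowerSeries ℝ) *
        ((1 - PowerSeries.X) ^ (n - 1 - k) * (eulerianPoly k : PowerSeries ℝ)) := by
    have := map_sum (Polynomial.coeToPowerSeries.ringHom (R := ℝ))
      (fun k => ((n + 1).choose (k + 1) : ℝ[X]) * ((1 - X) ^ (n - 1 - k) * eulerianPoly k))
      (Finset.range n)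
    simp only [Polynomial.coeToPowerSeries.ringHom_apply] at this
    rw [this]
    simp only [Polynomial.coe_mul, Polynomial.coe_pow, Polynomial.coe_sub, Polynomial.coe_one,
      Polynomial.coe_X, hcast]
  have hb := powerSumSeries_binomial (n + 1)
  rw [Finset.sum_range_succ, Nat.choose_self, Nat.cast_one, one_mul] at hb
  have h0 := powerSumSeries_zero_mul
  have hterm : (1 - PowerSeries.X) ^ (n + 2) * ∑ k ∈ Finset.range n,
      ((n + 1).choose (k + 1) : PowerSeries ℝ) * powerSumSeries (k + 1) =
      (1 - PowerSeries.X) * ∑ k ∈ Finset.range n, ((n + 1).choose (k + 1) : PowerSeries ℝ) *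
        ((1 - PowerSeries.X) ^ (n - 1 - k) * (eulerianPoly k : PowerSeries ℝ)) := by
    rw [Finset.mul_sum, Finset.mul_sum]
    refine Finset.sum_congr rfl fun k hk => ?_
    rw [Finset.mem_range] at hk
    rw [coe_eulerianPoly, show n + 2 = 1 + (n - 1 - k) + (k + 2) by omega, pow_add, pow_add,
      pow_one]
    ring
  simp only [Polynomial.coe_add, Polynomial.coe_mul, Polynomial.coe_pow, Polynomial.coe_one,
    Polynomial.coe_X, Polynomial.coe_sub, hsum]
  have hE := coe_eulerianPoly n
  linear_combination (1 - PowerSeries.X) * hE + (1 - PowerSeries.X) ^ (n + 2) * hb +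
    (1 - PowerSeries.X) ^ (n + 1) * h0 + PowerSeries.X * hterm

/-! ### Simplicial fans subdividing a simplicial cone -/

section Fan

variable {α V : Type*} [AddCommGroup V] [Module ℝ V]

/-- The convex cone spanned by the vectors `ℓ v`, `v ∈ s`. -/
def coneOn (ℓ : α → V) (s : Finset α) : Set V :=
  {q | ∃ a : α → ℝ, (∀ v ∈ s, 0 ≤ a v) ∧ ∑ v ∈ s, a v • ℓ v = q}

/-- `T` is a simplicial fan, its cones being spanned by the sets `ℓ '' s` for `s ∈ T`, whose support
is the simplicial cone spanned by `ℓ '' F`. That the cones meet along common faces is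
expressed by the disjointness of their relative interiors. -/
structure SubdividesCone (ℓ : α → V) (T : Finset (Finset α)) (F : Finset α) : Prop where
  indep : ∀ s ∈ T, LinearIndepOn ℝ ℓ (s : Set α)
  indep_base : LinearIndepOn ℝ ℓ (F : Set α)
  down_closed : ∀ s ∈ T, ∀ t ⊆ s, t ∈ T
  eq_of_sum_eq : ∀ s ∈ T, ∀ t ∈ T, ∀ a b : α → ℝ, (∀ v ∈ s, 0 < a v) → (∀ v ∈ t, 0 < b v) →
    ∑ v ∈ s, a v • ℓ v = ∑ v ∈ t, b v • ℓ v → s = t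
  mem_cone : ∀ s ∈ T, ∀ v ∈ s, ℓ v ∈ coneOn ℓ F
  cover : ∀ q ∈ coneOn ℓ F, ∃ s ∈ T, q ∈ coneOn ℓ s

/-- `ξ` lies in the linear span of `ℓ '' F` and in no span of a cone of `T` of smaller dimension. -/
structure IsGeneric (ℓ : α → V) (T : Finset (Finset α)) (F : Finset α) (ξ : V) : Prop where
  mem_span : ξ ∈ Submodule.span ℝ (ℓ '' (F : Set α))
  notMem_span : ∀ s ∈ T, s.card < F.card → ξ ∉ Submodule.span ℝ (ℓ '' (s : Set α))

lemma IsGeneric.neg {ℓ : α → V} {T : Finset (Finset α)} {F : Finset α} {ξ : V}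
    (h : IsGeneric ℓ T F ξ) : IsGeneric ℓ T F (-ξ) :=
  ⟨neg_mem h.mem_span, fun s hs hc hm => h.notMem_span s hs hc (by simpa using neg_mem hm)⟩

lemma sum_smul_mem_span (ℓ : α → V) (s : Finset α) (a : α → ℝ) :
    ∑ v ∈ s, a v • ℓ v ∈ Submodule.span ℝ (ℓ '' (s : Set α)) :=
  Submodule.sum_mem _ fun v hv =>
    Submodule.smul_mem _ _ (Submodule.subset_span ⟨v, hv, rfl⟩)

lemma exists_sum_smul_of_mem_span {ℓ : α → V} {s : Finset α} {q : V}
    (h : q ∈ Submodule.span ℝ (ℓ '' (s : Set α))) : ∃ a : α → ℝ, ∑ v ∈ s, a v • ℓ v = q := by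
  classical
  obtain ⟨c, hc⟩ := Submodule.mem_span_image_finset_iff_exists_fun ℝ |>.mp h
  refine ⟨fun v => if hv : v ∈ s then c ⟨v, hv⟩ else 0, ?_⟩
  rw [← hc, ← Finset.sum_coe_sort]
  simp

lemma coneOn_subset_span (ℓ : α → V) (s : Finset α) :
    coneOn ℓ s ⊆ Submodule.span ℝ (ℓ '' (s : Set α)) := by
  rintro _ ⟨a, -, rfl⟩
  exact sum_smul_mem_span ℓ s a

lemma coneOn_sum_mem {ℓ : α → V} {F : Finset α} {ι : Type*} {s : Finset ι} {b : ι → ℝ}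
    {g : ι → V} (hb : ∀ v ∈ s, 0 ≤ b v) (h : ∀ v ∈ s, g v ∈ coneOn ℓ F) :
    ∑ v ∈ s, b v • g v ∈ coneOn ℓ F := by
  classical
  choose! a ha hsum using h
  refine ⟨fun u => ∑ v ∈ s, b v * a v u, fun u hu => Finset.sum_nonneg fun v hv =>
    mul_nonneg (hb v hv) (ha v hv u hu), ?_⟩
  simp_rw [Finset.sum_smul]
  rw [Finset.sum_comm]
  refine Finset.sum_congr rfl fun v hv => ?_
  rw [← hsum v hv, Finset.smul_sum]
  simp [mul_smul]

lemma eq_of_sum_smul_eq {ℓ : α → V} {s : Finset α} (h : LinearIndepOn ℝ ℓ (s : Set α))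
    {a b : α → ℝ} (hab : ∑ v ∈ s, a v • ℓ v = ∑ v ∈ s, b v • ℓ v) : ∀ v ∈ s, a v = b v := by
  rw [linearIndepOn_finset_iff] at h
  intro v hv
  have := h (fun v => a v - b v) (by simp [sub_smul, hab]) v hv
  linarith

lemma finrank_span_image_eq_card {ℓ : α → V} {s : Finset α}
    (h : LinearIndepOn ℝ ℓ (s : Set α)) :
    Module.finrank ℝ (Submodule.span ℝ (ℓ '' (s : Set α))) = s.card := by
  have h' : LinearIndependent ℝ (fun x : (s : Set α) => ℓ x) := h
  have := finrank_span_eq_card h'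
  rw [← Set.image_eq_range] at this
  simpa using this

lemma exists_pos_lt_forall_pos {s : Finset α} (a c : α → ℝ) (ha : ∀ v ∈ s, 0 < a v) :
    ∃ ε₀ > (0 : ℝ), ∀ ε > (0 : ℝ), ε < ε₀ → ∀ v ∈ s, 0 < a v + ε * c v := by
  classical
  induction s using Finset.induction_on with
  | empty => exact ⟨1, one_pos, by simp⟩
  | insert u s hu ih =>
    obtain ⟨ε₁, h1, hs⟩ := ih fun v hv => ha v (Finset.mem_insert_of_mem hv)
    have hau := ha u (Finset.mem_insert_self u s)
    have hpos : 0 < a u / (|c u| + 1) := by positivity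
    refine ⟨min ε₁ (a u / (|c u| + 1)), lt_min h1 hpos, fun ε hε hlt v hv => ?_⟩
    rcases Finset.mem_insert.mp hv with rfl | hv
    · have h2 := hlt.trans_le (min_le_right _ _)
      rw [lt_div_iff₀ (by positivity)] at h2
      have h3 : -|c v| ≤ c v := neg_abs_le _
      nlinarith
    · exact hs ε hε (hlt.trans_le (min_le_left _ _)) v hv

namespace SubdividesCone

variable {ℓ : α → V} {T : Finset (Finset α)} {F : Finset α}

lemma span_le (h : SubdividesCone ℓ T F) {s : Finset α} (hs : s ∈ T) :
    Submodule.span ℝ (ℓ '' (s : Set α)) ≤ Submodule.span ℝ (ℓ '' (F : Set α)) := by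
  rw [Submodule.span_le]
  rintro _ ⟨v, hv, rfl⟩
  exact coneOn_subset_span ℓ F (h.mem_cone s hs v hv)

lemma card_le (h : SubdividesCone ℓ T F) {s : Finset α} (hs : s ∈ T) : s.card ≤ F.card := by
  rw [← finrank_span_image_eq_card (h.indep s hs), ← finrank_span_image_eq_card h.indep_base]
  have : FiniteDimensional ℝ (Submodule.span ℝ (ℓ '' (F : Set α))) :=
    FiniteDimensional.span_of_finite ℝ (F.finite_toSet.image ℓ)
  exact Submodule.finrank_mono (h.span_le hs)

lemma span_eq (h : SubdividesCone ℓ T F) {s : Finset α} (hs : s ∈ T) (hc : s.card = F.card) :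
    Submodule.span ℝ (ℓ '' (s : Set α)) = Submodule.span ℝ (ℓ '' (F : Set α)) := by
  have : FiniteDimensional ℝ (Submodule.span ℝ (ℓ '' (F : Set α))) :=
    FiniteDimensional.span_of_finite ℝ (F.finite_toSet.image ℓ)
  refine Submodule.eq_of_le_of_finrank_eq (h.span_le hs) ?_
  rw [finrank_span_image_eq_card (h.indep s hs), finrank_span_image_eq_card h.indep_base, hc]

/-- A vector in the interior of the cone can be perturbed to a generic one: on a line through it
in a generic direction each span contains at most one point. -/
lemma exists_isGeneric (h : SubdividesCone ℓ T F) :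
    ∃ a : α → ℝ, (∀ u ∈ F, 0 < a u) ∧ IsGeneric ℓ T F (∑ u ∈ F, a u • ℓ u) := by
  classical
  let L : (α → ℝ) →ₗ[ℝ] V := ∑ u ∈ F, (LinearMap.proj u).smulRight (ℓ u)
  have hL : ∀ a, L a = ∑ u ∈ F, a u • ℓ u := fun a => by simp [L]
  let W : Finset (Submodule ℝ (α → ℝ)) := (T.filter (·.card < F.card)).image
    fun s : Finset α => (Submodule.span ℝ (ℓ '' (s : Set α))).comap L
  have hW : ⊤ ∉ W := by
    intro hmem
    simp only [W, Finset.mem_image, Finset.mem_filter] at hmem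
    obtain ⟨s, ⟨hs, hc⟩, htop⟩ := hmem
    have : Submodule.span ℝ (ℓ '' (F : Set α)) ≤ Submodule.span ℝ (ℓ '' (s : Set α)) := by
      intro q hq
      obtain ⟨a, rfl⟩ := exists_sum_smul_of_mem_span hq
      have : a ∈ (Submodule.span ℝ (ℓ '' (s : Set α))).comap L := htop ▸ Submodule.mem_top
      rwa [Submodule.mem_comap, hL] at this
    have hfd : FiniteDimensional ℝ (Submodule.span ℝ (ℓ '' (s : Set α))) :=
      FiniteDimensional.span_of_finite ℝ (s.finite_toSet.image ℓ)
    have := Submodule.finrank_mono this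
    rw [finrank_span_image_eq_card (h.indep s hs), finrank_span_image_eq_card h.indep_base] at this
    omega
  obtain ⟨x, hx⟩ := (Set.ne_univ_iff_exists_notMem _).mp (Subspace.biUnion_ne_univ_of_top_notMem hW)
  simp only [Set.mem_iUnion, not_exists] at hx
  -- For each subspace, all but at most one point of the line `1 + ε x` lie outside of it.
  let B : Submodule ℝ (α → ℝ) → Set ℝ := fun w => {ε | (1 : α → ℝ) + ε • x ∈ w}
  have hB : ∀ w ∈ W, (B w).Finite := by
    intro w hw
    refine Set.Subsingleton.finite fun ε hε δ hδ => ?_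
    by_contra hne
    refine hx w hw ?_
    have h1 : (ε - δ) • x ∈ w := by
      have := w.sub_mem hε hδ
      rwa [add_sub_add_left_eq_sub, ← sub_smul] at this
    exact (w.smul_mem_iff (sub_ne_zero.mpr hne)).mp h1
  have hfin : (⋃ w ∈ W, B w).Finite := W.finite_toSet.biUnion hB
  obtain ⟨ε₀, hε₀, hpos⟩ := exists_pos_lt_forall_pos (s := F) 1 x (by simp)
  obtain ⟨ε, hε, hnot⟩ := (Set.Ioo_infinite hε₀).exists_notMem_finite hfin
  simp only [Set.mem_iUnion, not_exists] at hnot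
  refine ⟨1 + ε • x, fun u hu => by simpa using hpos ε hε.1 hε.2 u hu, ?_, ?_⟩
  · exact sum_smul_mem_span ℓ F _
  · intro s hs hc hm
    refine hnot ((Submodule.span ℝ (ℓ '' (s : Set α))).comap L) ?_ ?_
    · exact Finset.mem_image_of_mem _ (Finset.mem_filter.mpr ⟨hs, hc⟩)
    · have hmem : (1 : α → ℝ) + ε • x ∈ (Submodule.span ℝ (ℓ '' (s : Set α))).comap L := by
        rw [Submodule.mem_comap, hL]
        exact hm
      exact hmem

end SubdividesCone

/-- Coordinates of `ξ` with respect to the vectors `ℓ v`, `v ∈ s` (zero if there are none). -/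
def coordOn (ℓ : α → V) (ξ : V) (s : Finset α) : α → ℝ :=
  open Classical in
  if h : ∃ a : α → ℝ, ∑ v ∈ s, a v • ℓ v = ξ then h.choose else 0

lemma sum_coordOn {ℓ : α → V} {ξ : V} {s : Finset α}
    (h : ξ ∈ Submodule.span ℝ (ℓ '' (s : Set α))) :
    ∑ v ∈ s, coordOn ℓ ξ s v • ℓ v = ξ := by
  have h' := exists_sum_smul_of_mem_span h
  rw [coordOn, dif_pos h']
  exact h'.choose_spec

namespace SubdividesCone

variable {ℓ : α → V} {T : Finset (Finset α)} {F : Finset α} {ξ : V}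

lemma sum_coordOn_eq (h : SubdividesCone ℓ T F) (hξ : IsGeneric ℓ T F ξ) {s : Finset α}
    (hs : s ∈ T) (hc : s.card = F.card) : ∑ v ∈ s, coordOn ℓ ξ s v • ℓ v = ξ :=
  sum_coordOn (by rw [h.span_eq hs hc]; exact hξ.mem_span)

lemma coordOn_ne_zero (h : SubdividesCone ℓ T F) (hξ : IsGeneric ℓ T F ξ) {s : Finset α}
    (hs : s ∈ T) (hc : s.card = F.card) {v : α} (hv : v ∈ s) : coordOn ℓ ξ s v ≠ 0 := by
  classical
  intro h0
  refine hξ.notMem_span (s.erase v) (h.down_closed s hs _ (Finset.erase_subset v s)) ?_ ?_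
  · rw [← hc]; exact Finset.card_erase_lt_of_mem hv
  · have := h.sum_coordOn_eq hξ hs hc
    rw [← Finset.add_sum_erase _ _ hv, h0, zero_smul, zero_add] at this
    rw [← this]
    exact sum_smul_mem_span ℓ _ _

lemma coordOn_neg (h : SubdividesCone ℓ T F) (hξ : IsGeneric ℓ T F ξ) {s : Finset α}
    (hs : s ∈ T) (hc : s.card = F.card) {v : α} (hv : v ∈ s) :
    coordOn ℓ (-ξ) s v = -coordOn ℓ ξ s v := by
  refine eq_of_sum_smul_eq (b := fun v => -coordOn ℓ ξ s v) (h.indep s hs) ?_ v hv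
  rw [h.sum_coordOn_eq hξ.neg hs hc]
  simp [h.sum_coordOn_eq hξ hs hc]

/-- If a cone of the fan contains the sum of the generators of another one, then the
latter is a face of it. -/
lemma subset_of_sum_eq (h : SubdividesCone ℓ T F) {s t : Finset α} (hs : s ∈ T) (ht : t ∈ T)
    {a : α → ℝ} (ha : ∀ v ∈ t, 0 ≤ a v) (hsum : ∑ v ∈ s, ℓ v = ∑ v ∈ t, a v • ℓ v) :
    s ⊆ t ∧ ∀ v ∈ t, v ∉ s → a v = 0 := by
  classical
  have key : s = t.filter (fun v => 0 < a v) := by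
    refine h.eq_of_sum_eq s hs _ (h.down_closed t ht _ (Finset.filter_subset _ _)) 1 a (by simp)
      (by simp) ?_
    simp only [Pi.one_apply, one_smul]
    rw [hsum, Finset.sum_filter_of_ne]
    intro v hv hne
    exact lt_of_le_of_ne (ha v hv) fun h0 => hne (by rw [← h0, zero_smul])
  refine ⟨key ▸ Finset.filter_subset _ _, fun v hv hvs => ?_⟩
  rw [key, Finset.mem_filter, not_and, not_lt] at hvs
  exact le_antisymm (hvs hv) (ha v hv)

/-- If the barycentre of `s`, moved slightly in the generic direction `ξ`, stays in the
cone, then it enters the interior of a top-dimensional cone of which `s` is a face. -/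
lemma exists_top (h : SubdividesCone ℓ T F) (hξ : IsGeneric ℓ T F ξ) {s : Finset α} (hs : s ∈ T)
    (hQ : ∀ ε₀ > (0 : ℝ), ∃ ε > (0 : ℝ), ε < ε₀ ∧ ∑ v ∈ s, ℓ v + ε • ξ ∈ coneOn ℓ F) :
    ∃ t ∈ T, t.card = F.card ∧ s ⊆ t ∧ ∀ v ∈ t, v ∉ s → 0 < coordOn ℓ ξ t v := by
  classical
  -- By finiteness, one cone of the fan contains the moved point for arbitrarily small `ε`.
  obtain ⟨t, ht, hcof⟩ : ∃ t ∈ T, ∀ ε₀ > (0 : ℝ), ∃ ε > (0 : ℝ), ε < ε₀ ∧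
      ∑ v ∈ s, ℓ v + ε • ξ ∈ coneOn ℓ t := by
    by_contra! hcon
    choose! e he hne using hcon
    have hT : T.Nonempty := ⟨s, hs⟩
    obtain ⟨ε, hε, hlt, hmem⟩ := hQ (T.inf' hT e) (by rw [gt_iff_lt, Finset.lt_inf'_iff]; exact he)
    obtain ⟨t, ht, hmt⟩ := h.cover _ hmem
    exact hne t ht ε hε (hlt.trans_le (Finset.inf'_le _ ht)) hmt
  have hspan := coneOn_subset_span ℓ t
  obtain ⟨ε₁, hε₁, -, h1⟩ := hcof 1 one_pos
  obtain ⟨ε₂, hε₂, hlt, h2⟩ := hcof ε₁ hε₁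
  have hξt : ξ ∈ Submodule.span ℝ (ℓ '' (t : Set α)) := by
    have := Submodule.sub_mem _ (hspan h1) (hspan h2)
    rw [add_sub_add_left_eq_sub, ← sub_smul] at this
    exact (Submodule.smul_mem_iff _ (sub_pos.mpr hlt).ne').mp this
  have hpt : ∑ v ∈ s, ℓ v ∈ Submodule.span ℝ (ℓ '' (t : Set α)) := by
    have := Submodule.sub_mem _ (hspan h1) (Submodule.smul_mem _ ε₁ hξt)
    simpa using this
  have hc : t.card = F.card := by
    by_contra hne
    exact hξ.notMem_span t ht (lt_of_le_of_ne (h.card_le ht) hne) hξt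
  obtain ⟨p, hp⟩ := exists_sum_smul_of_mem_span hpt
  have hx := sum_coordOn hξt
  set x := coordOn ℓ ξ t with hxdef
  have hcoord : ∀ ε, ∑ v ∈ s, ℓ v + ε • ξ ∈ coneOn ℓ t → ∀ v ∈ t, 0 ≤ p v + ε * x v := by
    rintro ε ⟨a, ha, hsum⟩ v hv
    have := eq_of_sum_smul_eq (h.indep t ht) (a := fun v => p v + ε * x v) (b := a) (by
      rw [hsum, ← hp]
      conv_rhs => rw [← hx]
      rw [Finset.smul_sum, ← Finset.sum_add_distrib]
      exact Finset.sum_congr rfl fun v _ => by rw [add_smul, mul_smul]) v hv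
    rw [this]
    exact ha v hv
  have hp0 : ∀ v ∈ t, 0 ≤ p v := by
    intro v hv
    by_contra! hneg
    have hq : 0 < -p v / (|x v| + 1) := div_pos (by linarith) (by positivity)
    obtain ⟨ε, hε, hlt, hm⟩ := hcof _ hq
    have h3 := hcoord ε hm v hv
    rw [lt_div_iff₀ (by positivity)] at hlt
    nlinarith [le_abs_self (x v)]
  obtain ⟨hst, hzero⟩ := h.subset_of_sum_eq hs ht hp0 hp.symm
  refine ⟨t, ht, hc, hst, fun v hv hvs => ?_⟩
  have h4 := hcoord ε₁ h1 v hv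
  rw [hzero v hv hvs, zero_add] at h4
  exact lt_of_le_of_ne (nonneg_of_mul_nonneg_right h4 hε₁) (h.coordOn_ne_zero hξ ht hc hv).symm

/-- Near the barycentre of a face `s` of the top-dimensional cone `t`, in a direction
with positive coordinates at the remaining generators, one stays in the interior of the cone. -/
lemma exists_forall_pos (h : SubdividesCone ℓ T F) (hξ : IsGeneric ℓ T F ξ) {s t : Finset α}
    (ht : t ∈ T) (hc : t.card = F.card) (hst : s ⊆ t)
    (hpos : ∀ v ∈ t, v ∉ s → 0 < coordOn ℓ ξ t v) :
    ∃ ε₀ > (0 : ℝ), ∀ ε > (0 : ℝ), ε < ε₀ → ∃ a : α → ℝ, (∀ v ∈ t, 0 < a v) ∧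
      ∑ v ∈ t, a v • ℓ v = ∑ v ∈ s, ℓ v + ε • ξ := by
  classical
  obtain ⟨ε₀, hε₀, hs⟩ := exists_pos_lt_forall_pos (s := s) 1 (coordOn ℓ ξ t) (by simp)
  refine ⟨ε₀, hε₀, fun ε hε hlt => ⟨fun v => (if v ∈ s then 1 else 0) + ε * coordOn ℓ ξ t v,
    fun v hv => ?_, ?_⟩⟩
  · by_cases hvs : v ∈ s
    · simpa [hvs] using hs ε hε hlt v hvs
    · simpa [hvs] using mul_pos hε (hpos v hv hvs)
  · conv_rhs => rw [← h.sum_coordOn_eq hξ ht hc]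
    simp only [add_smul, Finset.sum_add_distrib, mul_smul, Finset.smul_sum]
    congr 1
    simp only [ite_smul, one_smul, zero_smul, ← Finset.sum_filter]
    congr 1
    ext v
    simpa using fun hv => hst hv

lemma top_unique (h : SubdividesCone ℓ T F) (hξ : IsGeneric ℓ T F ξ) {s t t' : Finset α}
    (ht : t ∈ T) (hc : t.card = F.card) (hst : s ⊆ t)
    (hpos : ∀ v ∈ t, v ∉ s → 0 < coordOn ℓ ξ t v)
    (ht' : t' ∈ T) (hc' : t'.card = F.card) (hst' : s ⊆ t')
    (hpos' : ∀ v ∈ t', v ∉ s → 0 < coordOn ℓ ξ t' v) : t = t' := by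
  obtain ⟨ε₁, h1, h1'⟩ := h.exists_forall_pos hξ ht hc hst hpos
  obtain ⟨ε₂, h2, h2'⟩ := h.exists_forall_pos hξ ht' hc' hst' hpos'
  have hm : 0 < min ε₁ ε₂ / 2 := half_pos (lt_min h1 h2)
  have hl : min ε₁ ε₂ / 2 < min ε₁ ε₂ := half_lt_self (lt_min h1 h2)
  obtain ⟨a, ha, hsa⟩ := h1' _ hm (hl.trans_le (min_le_left _ _))
  obtain ⟨b, hb, hsb⟩ := h2' _ hm (hl.trans_le (min_le_right _ _))
  exact h.eq_of_sum_eq t ht t' ht' a b ha hb (hsa.trans hsb.symm)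

lemma coneOn_subset (h : SubdividesCone ℓ T F) {t : Finset α} (ht : t ∈ T) :
    coneOn ℓ t ⊆ coneOn ℓ F := by
  rintro _ ⟨a, ha, rfl⟩
  exact coneOn_sum_mem ha (h.mem_cone t ht)

/-- The faces of the fan near which one can move in the direction `ξ` within the cone are
partitioned into intervals, one for each top-dimensional cone `t`: the interval consists
of the faces of `t` containing all generators at which `ξ` has negative coordinate. -/
lemma sum_eq_sum_Icc [DecidableEq α] {M : Type*} [AddCommMonoid M] (h : SubdividesCone ℓ T F)
    (hξ : IsGeneric ℓ T F ξ) (Q : Finset α → Prop) [DecidablePred Q]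
    (hQ : ∀ s ∈ T, Q s ↔ ∀ ε₀ > (0 : ℝ), ∃ ε > (0 : ℝ), ε < ε₀ ∧ ∑ v ∈ s, ℓ v + ε • ξ ∈ coneOn ℓ F)
    (g : Finset α → M) :
    ∑ s ∈ T.filter Q, g s = ∑ t ∈ T.filter (·.card = F.card),
      ∑ s ∈ Finset.Icc (t.filter fun v => coordOn ℓ ξ t v < 0) t, g s := by
  classical
  have hgood : ∀ t ∈ T, t.card = F.card → ∀ s,
      s ∈ Finset.Icc (t.filter fun v => coordOn ℓ ξ t v < 0) t ↔
        s ⊆ t ∧ ∀ v ∈ t, v ∉ s → 0 < coordOn ℓ ξ t v := by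
    intro t ht hc s
    simp only [Finset.mem_Icc]
    rw [and_comm]
    refine and_congr_right fun hst => ⟨fun hn v hv hvs => ?_, fun hp v hv => ?_⟩
    · refine lt_of_le_of_ne (not_lt.mp fun hlt => hvs (hn ?_)) (h.coordOn_ne_zero hξ ht hc hv).symm
      exact Finset.mem_filter.mpr ⟨hv, hlt⟩
    · rw [Finset.mem_filter] at hv
      by_contra hvs
      exact absurd hv.2 (not_lt.mpr (hp v hv.1 hvs).le)
  rw [Finset.sum_sigma']
  symm
  refine Finset.sum_bij (fun p _ => p.2) ?_ ?_ ?_ ?_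
  · rintro ⟨t, s⟩ hp
    simp only [Finset.mem_sigma, Finset.mem_filter] at hp ⊢
    obtain ⟨⟨ht, hc⟩, hI⟩ := hp
    obtain ⟨hst, hpos⟩ := (hgood t ht hc s).mp hI
    have hsT := h.down_closed t ht s hst
    refine ⟨hsT, (hQ s hsT).mpr fun ε₀ hε₀ => ?_⟩
    obtain ⟨ε₁, hε₁, hin⟩ := h.exists_forall_pos hξ ht hc hst hpos
    have hm := lt_min hε₀ hε₁
    refine ⟨min ε₀ ε₁ / 2, half_pos hm, (half_lt_self hm).trans_le (min_le_left _ _), ?_⟩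
    obtain ⟨a, ha, hsum⟩ := hin _ (half_pos hm) ((half_lt_self hm).trans_le (min_le_right _ _))
    rw [← hsum]
    exact h.coneOn_subset ht ⟨a, fun v hv => (ha v hv).le, rfl⟩
  · rintro ⟨t, s⟩ hp ⟨t', s'⟩ hp' heq
    simp only [Finset.mem_sigma, Finset.mem_filter] at hp hp'
    obtain rfl : s = s' := heq
    obtain ⟨⟨ht, hc⟩, hI⟩ := hp
    obtain ⟨⟨ht', hc'⟩, hI'⟩ := hp'
    obtain ⟨hst, hpos⟩ := (hgood t ht hc s).mp hI
    obtain ⟨hst', hpos'⟩ := (hgood t' ht' hc' s).mp hI'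
    rw [h.top_unique hξ ht hc hst hpos ht' hc' hst' hpos']
  · intro s hs
    rw [Finset.mem_filter] at hs
    obtain ⟨t, ht, hc, hst, hpos⟩ := h.exists_top hξ hs.1 ((hQ s hs.1).mp hs.2)
    exact ⟨⟨t, s⟩, by
      simp only [Finset.mem_sigma, Finset.mem_filter]
      exact ⟨⟨ht, hc⟩, (hgood t ht hc s).mpr ⟨hst, hpos⟩⟩, rfl⟩
  · intros; rfl

end SubdividesCone

lemma sum_Icc_pow_mul_pow {R : Type*} [CommSemiring R] [DecidableEq α] (y z : R) {s t : Finset α}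
    (hst : s ⊆ t) :
    ∑ r ∈ Finset.Icc s t, y ^ (r.card - s.card) * z ^ (t.card - r.card) =
      (y + z) ^ (t.card - s.card) := by
  have hd : ∀ r ⊆ t \ s, Disjoint s r := fun r hr => Finset.disjoint_sdiff.mono_right hr
  rw [Finset.Icc_eq_image_powerset hst, Finset.sum_image]
  · rw [← Finset.card_sdiff_of_subset hst, ← Finset.sum_pow_mul_eq_add_pow]
    refine Finset.sum_congr rfl fun r hr => ?_
    rw [Finset.card_union_of_disjoint (hd r (Finset.mem_powerset.mp hr)), Nat.add_sub_cancel_left,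
      Nat.sub_add_eq, Finset.card_sdiff_of_subset hst]
  · intro r hr r' hr' heq
    simp only [Finset.coe_powerset, Set.mem_preimage, Set.mem_powerset_iff,
      Finset.coe_subset] at hr hr'
    have := congrArg (· \ s) heq
    simpa [Finset.union_sdiff_cancel_left (hd r hr), Finset.union_sdiff_cancel_left (hd r' hr')]
      using this

lemma sum_Icc_pow_mul_one_sub_pow {R : Type*} [CommRing R] [DecidableEq α] (x : R)
    {s t : Finset α} (hst : s ⊆ t) :
    ∑ r ∈ Finset.Icc s t, x ^ r.card * (1 - x) ^ (t.card - r.card) = x ^ s.card := by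
  have h := sum_Icc_pow_mul_pow x (1 - x) hst
  rw [add_sub_cancel, one_pow] at h
  rw [← mul_one (x ^ s.card), ← congrArg (x ^ s.card * ·) h, Finset.mul_sum]
  refine Finset.sum_congr rfl fun r hr => ?_
  rw [← mul_assoc, ← pow_add, Nat.add_sub_cancel' (Finset.card_le_card (Finset.mem_Icc.mp hr).1)]

namespace SubdividesCone

variable {ℓ : α → V} {T : Finset (Finset α)} {F : Finset α}

/-- Reciprocity for a subdivision of a simplicial cone: the `h`-polynomial and that of the
set of interior faces enumerate the top-dimensional cones by the number of negative, respectively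
positive, coordinates of one and the same generic vector. -/
theorem exists_hPoly_eq_sum [DecidableEq α] (h : SubdividesCone ℓ T F) (hempty : ∅ ∈ T)
    (I : Finset α → Prop) [DecidablePred I]
    (hI : ∀ s ∈ T, I s ↔ ∀ u ∈ F, ∃ v ∈ s, ℓ v ∉ coneOn ℓ (F.erase u)) :
    ∃ (M : Finset (Finset α)) (k : Finset α → ℕ), M ⊆ T ∧ M.Nonempty ∧
      (∀ t ∈ M, t.card = F.card ∧ k t ≤ F.card) ∧
      ∑ s ∈ T, (X : ℝ[X]) ^ s.card * (1 - X) ^ (F.card - s.card) = ∑ t ∈ M, X ^ k t ∧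
      ∑ s ∈ T.filter I, (X : ℝ[X]) ^ s.card * (1 - X) ^ (F.card - s.card) =
        ∑ t ∈ M, X ^ (F.card - k t) := by
  classical
  obtain ⟨x, hx, hξ⟩ := h.exists_isGeneric
  set ξ := ∑ u ∈ F, x u • ℓ u with hξdef
  have hall : ∀ s ∈ T, ∀ ε₀ : ℝ, 0 < ε₀ →
      ∃ ε > 0, ε < ε₀ ∧ ∑ v ∈ s, ℓ v + ε • ξ ∈ coneOn ℓ F := by
    intro s hs ε₀ hε₀
    refine ⟨ε₀ / 2, half_pos hε₀, half_lt_self hε₀, ?_⟩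
    obtain ⟨a, ha, hsum⟩ := h.coneOn_subset hs ⟨1, by simp, rfl⟩
    simp only [Pi.one_apply, one_smul] at hsum
    refine ⟨fun u => a u + ε₀ / 2 * x u, fun u hu => ?_, ?_⟩
    · have := hx u hu
      have := ha u hu
      positivity
    · rw [hξdef, ← hsum, Finset.smul_sum, ← Finset.sum_add_distrib]
      exact Finset.sum_congr rfl fun u _ => by rw [add_smul, mul_smul]
  -- Since `ξ` has positive coordinates, exactly the interior faces can be moved along `-ξ`.
  have hint : ∀ s ∈ T, I s ↔ ∀ ε₀ > (0 : ℝ), ∃ ε > (0 : ℝ), ε < ε₀ ∧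
      ∑ v ∈ s, ℓ v + ε • -ξ ∈ coneOn ℓ F := by
    intro s hs
    rw [hI s hs]
    choose! a ha hsum using h.mem_cone s hs
    have hp : ∑ v ∈ s, ℓ v = ∑ u ∈ F, (∑ v ∈ s, a v u) • ℓ u := by
      simp_rw [Finset.sum_smul]
      rw [Finset.sum_comm]
      exact Finset.sum_congr rfl fun v hv => (hsum v hv).symm
    have hmove : ∀ ε : ℝ, ∑ v ∈ s, ℓ v + ε • -ξ =
        ∑ u ∈ F, ((∑ v ∈ s, a v u) + ε * -x u) • ℓ u := by
      intro ε
      rw [hp, hξdef, ← Finset.sum_neg_distrib, Finset.smul_sum, ← Finset.sum_add_distrib]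
      exact Finset.sum_congr rfl fun u _ => by rw [add_smul, mul_smul, neg_smul]
    constructor
    · intro hi
      have hpos : ∀ u ∈ F, 0 < ∑ v ∈ s, a v u := by
        intro u hu
        obtain ⟨v, hv, hvu⟩ := hi u hu
        refine Finset.sum_pos' (fun w hw => ha w hw u hu) ⟨v, hv, ?_⟩
        refine lt_of_le_of_ne (ha v hv u hu) fun h0 => hvu
          ⟨a v, fun w hw => ha v hv w (Finset.mem_of_mem_erase hw), ?_⟩
        rw [← hsum v hv, ← Finset.add_sum_erase _ _ hu, ← h0, zero_smul, zero_add]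
      obtain ⟨ε₁, hε₁, hε⟩ := exists_pos_lt_forall_pos _ (fun u => -x u) hpos
      intro ε₀ hε₀
      have hm := lt_min hε₀ hε₁
      refine ⟨min ε₀ ε₁ / 2, half_pos hm, (half_lt_self hm).trans_le (min_le_left _ _), ?_⟩
      rw [hmove]
      exact ⟨_, fun u hu => (hε _ (half_pos hm)
        ((half_lt_self hm).trans_le (min_le_right _ _)) u hu).le, rfl⟩
    · intro hQ u hu
      by_contra! hcon
      obtain ⟨ε, hε, -, b, hb, hbsum⟩ := hQ 1 one_pos
      have hz : ∑ v ∈ s, a v u = 0 := by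
        refine Finset.sum_eq_zero fun v hv => ?_
        obtain ⟨c, hc, hcsum⟩ := hcon v hv
        have := eq_of_sum_smul_eq h.indep_base (a := a v) (b := fun w => if w = u then 0 else c w)
          (by rw [hsum v hv, ← Finset.add_sum_erase _ _ hu, ← hcsum]
              simp only [if_true, zero_smul, zero_add]
              exact Finset.sum_congr rfl fun w hw => by
                rw [if_neg (Finset.ne_of_mem_erase hw)]) u hu
        simpa using this
      have := eq_of_sum_smul_eq h.indep_base (hbsum.trans (hmove ε)) u hu
      rw [hz] at this
      nlinarith [hb u hu, hx u hu]
  have e1 := h.sum_eq_sum_Icc hξ (fun _ => True) (fun s hs => by simpa using hall s hs)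
    (fun s => (X : ℝ[X]) ^ s.card * (1 - X) ^ (F.card - s.card))
  have e2 := h.sum_eq_sum_Icc hξ.neg I hint
    (fun s => (X : ℝ[X]) ^ s.card * (1 - X) ^ (F.card - s.card))
  obtain ⟨t₀, ht₀, hc₀, -⟩ := h.exists_top hξ hempty (hall ∅ hempty)
  refine ⟨T.filter (·.card = F.card), fun t => (t.filter fun v => coordOn ℓ ξ t v < 0).card,
    Finset.filter_subset _ _, ⟨t₀, Finset.mem_filter.mpr ⟨ht₀, hc₀⟩⟩, ?_, ?_, ?_⟩
  · intro t ht
    have hc := (Finset.mem_filter.mp ht).2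
    exact ⟨hc, hc ▸ Finset.card_filter_le _ _⟩
  · rw [Finset.filter_true] at e1
    rw [e1]
    refine Finset.sum_congr rfl fun t ht => ?_
    rw [← (Finset.mem_filter.mp ht).2, sum_Icc_pow_mul_one_sub_pow _ (Finset.filter_subset _ _)]
  · rw [e2]
    refine Finset.sum_congr rfl fun t ht => ?_
    obtain ⟨htT, hc⟩ := Finset.mem_filter.mp ht
    rw [← hc, sum_Icc_pow_mul_one_sub_pow _ (Finset.filter_subset _ _)]
    congr 1
    have hsplit := Finset.card_filter_add_card_filter_not (s := t) (fun v => coordOn ℓ ξ t v < 0)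
    suffices (t.filter fun v => coordOn ℓ (-ξ) t v < 0).card =
        (t.filter fun v => ¬ coordOn ℓ ξ t v < 0).card by
      simp only
      omega
    congr 1
    refine Finset.filter_congr fun v hv => ?_
    rw [h.coordOn_neg hξ htT hc hv]
    have := h.coordOn_ne_zero hξ htT hc hv
    rw [neg_lt_zero, not_lt]
    exact ⟨le_of_lt, fun hle => lt_of_le_of_ne hle this.symm⟩

end SubdividesCone

end Fan

/-! ### The `h`-polynomials of links -/

section Links

/-- For a family `D` of finite sets with at most `d` elements, closed under taking subsets, and
`F ∈ D`, the `h`-polynomial of the link of `F`, regarded as a complex of dimension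
`d - |F| - 1`. -/
def linkPoly {α : Type*} [DecidableEq α] (D : Finset (Finset α)) (d : ℕ) (F : Finset α) : ℝ[X] :=
  ∑ G ∈ D.filter (F ⊆ ·), X ^ (G.card - F.card) * (1 - X) ^ (d - G.card)

/-! ### Chains of finite sets -/

variable {β : Type*}

lemma card_add_card_add_one {L M U : Finset β} (hLM : L ⊂ M) (hMU : M ⊂ U) :
    (M.card - L.card - 1) + (U.card - M.card - 1) + 1 = U.card - L.card - 1 := by
  have := Finset.card_lt_card hLM
  have := Finset.card_lt_card hMU
  omega

variable [DecidableEq β]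

/-- The chains of finite sets lying strictly between `L` and `U`. -/
def chains (L U : Finset β) : Finset (Finset (Finset β)) :=
  open Classical in
  (Finset.Ioo L U).powerset.filter fun c => IsChain (· ⊆ ·) (c : Set (Finset β))

lemma mem_chains {L U : Finset β} {c : Finset (Finset β)} :
    c ∈ chains L U ↔ (∀ s ∈ c, L ⊂ s ∧ s ⊂ U) ∧ IsChain (· ⊆ ·) (c : Set (Finset β)) := by
  classical
  simp [chains, Finset.subset_iff]

lemma card_le_of_mem_chains {L U : Finset β} {c : Finset (Finset β)} (h : c ∈ chains L U) :
    c.card ≤ U.card - L.card - 1 := by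
  rw [mem_chains] at h
  have hinj : Set.InjOn Finset.card (c : Set (Finset β)) := by
    intro s hs t ht hst
    rcases h.2.total hs ht with h1 | h1
    · exact Finset.eq_of_subset_of_card_le h1 hst.ge
    · exact (Finset.eq_of_subset_of_card_le h1 hst.le).symm
  rw [← Finset.card_image_of_injOn hinj]
  have : c.image Finset.card ⊆ Finset.Ioo L.card U.card := by
    intro k hk
    obtain ⟨s, hs, rfl⟩ := Finset.mem_image.mp hk
    exact Finset.mem_Ioo.mpr ⟨Finset.card_lt_card (h.1 s hs).1, Finset.card_lt_card (h.1 s hs).2⟩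
  simpa using Finset.card_le_card this

lemma union_mem_chains {L M U : Finset β} (hLM : L ⊂ M) (hMU : M ⊂ U)
    {c₁ c₂ : Finset (Finset β)} (h₁ : c₁ ∈ chains L M) (h₂ : c₂ ∈ chains M U) :
    insert M (c₁ ∪ c₂) ∈ chains L U := by
  rw [mem_chains] at h₁ h₂ ⊢
  constructor
  · intro s hs
    rcases Finset.mem_insert.mp hs with rfl | hs
    · exact ⟨hLM, hMU⟩
    rcases Finset.mem_union.mp hs with hs | hs
    · exact ⟨(h₁.1 s hs).1, (h₁.1 s hs).2.trans hMU⟩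
    · exact ⟨hLM.trans (h₂.1 s hs).1, (h₂.1 s hs).2⟩
  · intro s hs t ht hne
    simp only [Finset.coe_insert, Finset.coe_union, Set.mem_insert_iff, Set.mem_union,
      Finset.mem_coe] at hs ht
    rcases hs with rfl | hs | hs <;> rcases ht with rfl | ht | ht
    · exact absurd rfl hne
    · exact Or.inr (h₁.1 t ht).2.subset
    · exact Or.inl (h₂.1 t ht).1.subset
    · exact Or.inl (h₁.1 s hs).2.subset
    · exact h₁.2 hs ht hne
    · exact Or.inl ((h₁.1 s hs).2.trans (h₂.1 t ht).1).subset
    · exact Or.inr (h₂.1 s hs).1.subset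
    · exact Or.inr ((h₁.1 t ht).2.trans (h₂.1 s hs).1).subset
    · exact h₂.2 hs ht hne

lemma filter_below_mem_chains {L M U : Finset β} {c : Finset (Finset β)} (h : c ∈ chains L U) :
    c.filter (· ⊂ M) ∈ chains L M := by
  rw [mem_chains] at h ⊢
  refine ⟨fun s hs => ?_, h.2.mono (Finset.coe_subset.mpr (Finset.filter_subset _ _))⟩
  rw [Finset.mem_filter] at hs
  exact ⟨(h.1 s hs.1).1, hs.2⟩

lemma filter_above_mem_chains {L M U : Finset β} {c : Finset (Finset β)} (h : c ∈ chains L U) :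
    c.filter (M ⊂ ·) ∈ chains M U := by
  rw [mem_chains] at h ⊢
  refine ⟨fun s hs => ?_, h.2.mono (Finset.coe_subset.mpr (Finset.filter_subset _ _))⟩
  rw [Finset.mem_filter] at hs
  exact ⟨hs.2, (h.1 s hs.1).2⟩

lemma insert_filter_union_filter {L M U : Finset β} {c : Finset (Finset β)} (h : c ∈ chains L U)
    (hM : M ∈ c) : insert M (c.filter (· ⊂ M) ∪ c.filter (M ⊂ ·)) = c := by
  ext s
  simp only [Finset.mem_insert, Finset.mem_union, Finset.mem_filter]
  constructor
  · rintro (rfl | h | h)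
    exacts [hM, h.1, h.1]
  · intro hs
    by_cases hsM : s = M
    · exact Or.inl hsM
    · rcases (mem_chains.mp h).2 hs hM hsM with h1 | h1
      · exact Or.inr (Or.inl ⟨hs, h1.ssubset_of_ne hsM⟩)
      · exact Or.inr (Or.inr ⟨hs, h1.ssubset_of_ne (Ne.symm hsM)⟩)

lemma filter_below_union {L M U : Finset β} {c₁ c₂ : Finset (Finset β)} (h₁ : c₁ ∈ chains L M)
    (h₂ : c₂ ∈ chains M U) : (insert M (c₁ ∪ c₂)).filter (· ⊂ M) = c₁ := by
  rw [mem_chains] at h₁ h₂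
  ext s
  simp only [Finset.mem_insert, Finset.mem_union, Finset.mem_filter]
  constructor
  · rintro ⟨rfl | h | h, hs⟩
    · exact absurd hs (ssubset_irrefl _)
    · exact h
    · exact absurd hs (h₂.1 s h).1.asymm
  · exact fun h => ⟨Or.inr (Or.inl h), (h₁.1 s h).2⟩

lemma filter_above_union {L M U : Finset β} {c₁ c₂ : Finset (Finset β)} (h₁ : c₁ ∈ chains L M)
    (h₂ : c₂ ∈ chains M U) : (insert M (c₁ ∪ c₂)).filter (M ⊂ ·) = c₂ := by
  rw [mem_chains] at h₁ h₂
  ext s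
  simp only [Finset.mem_insert, Finset.mem_union, Finset.mem_filter]
  constructor
  · rintro ⟨rfl | h | h, hs⟩
    · exact absurd hs (ssubset_irrefl _)
    · exact absurd hs (h₁.1 s h).2.asymm
    · exact h
  · exact fun h => ⟨Or.inr (Or.inr h), (h₂.1 s h).1⟩

lemma card_insert_union {L M U : Finset β} {c₁ c₂ : Finset (Finset β)} (h₁ : c₁ ∈ chains L M)
    (h₂ : c₂ ∈ chains M U) : (insert M (c₁ ∪ c₂)).card = c₁.card + c₂.card + 1 := by
  rw [mem_chains] at h₁ h₂
  rw [Finset.card_insert_of_notMem, Finset.card_union_of_disjoint]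
  · rw [Finset.disjoint_left]
    exact fun s h h' => (h₁.1 s h).2.asymm (h₂.1 s h').1
  · intro hM
    rcases Finset.mem_union.mp hM with h | h
    · exact ssubset_irrefl _ (h₁.1 M h).2
    · exact ssubset_irrefl _ (h₂.1 M h).1

/-- The `h`-polynomial of the link of a chain through `M` is the product of those of the parts
of the chain below and above `M`. -/
lemma linkPoly_chains_mul {L M U : Finset β} {c : Finset (Finset β)} (h : c ∈ chains L U)
    (hM : M ∈ c) : linkPoly (chains L U) (U.card - L.card - 1) c =
      linkPoly (chains L M) (M.card - L.card - 1) (c.filter (· ⊂ M)) *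
      linkPoly (chains M U) (U.card - M.card - 1) (c.filter (M ⊂ ·)) := by
  obtain ⟨hLM, hMU⟩ := (mem_chains.mp h).1 M hM
  have hb := filter_below_mem_chains (M := M) h
  have ha := filter_above_mem_chains (M := M) h
  have hcc := card_insert_union hb ha
  rw [insert_filter_union_filter h hM] at hcc
  have hd := card_add_card_add_one hLM hMU
  rw [linkPoly, linkPoly, linkPoly, Finset.sum_mul_sum, ← Finset.sum_product']
  refine Finset.sum_bij' (fun e _ => (e.filter (· ⊂ M), e.filter (M ⊂ ·)))
    (fun p _ => insert M (p.1 ∪ p.2)) ?_ ?_ ?_ ?_ ?_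
  · intro e he
    obtain ⟨he, hce⟩ := Finset.mem_filter.mp he
    simp only [Finset.mem_product, Finset.mem_filter]
    exact ⟨⟨filter_below_mem_chains he, Finset.filter_subset_filter _ hce⟩,
      ⟨filter_above_mem_chains he, Finset.filter_subset_filter _ hce⟩⟩
  · rintro ⟨c₁, c₂⟩ hp
    simp only [Finset.mem_product, Finset.mem_filter] at hp
    rw [Finset.mem_filter]
    refine ⟨union_mem_chains hLM hMU hp.1.1 hp.2.1, ?_⟩
    rw [← insert_filter_union_filter h hM]
    exact Finset.insert_subset_insert _ (Finset.union_subset_union hp.1.2 hp.2.2)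
  · intro e he
    obtain ⟨he, hce⟩ := Finset.mem_filter.mp he
    exact insert_filter_union_filter he (hce hM)
  · rintro ⟨c₁, c₂⟩ hp
    simp only [Finset.mem_product, Finset.mem_filter] at hp
    simp only [filter_below_union hp.1.1 hp.2.1, filter_above_union hp.1.1 hp.2.1]
  · intro e he
    obtain ⟨he, hce⟩ := Finset.mem_filter.mp he
    have hb' := filter_below_mem_chains (M := M) he
    have ha' := filter_above_mem_chains (M := M) he
    have hce' := card_insert_union hb' ha'
    rw [insert_filter_union_filter he (hce hM)] at hce'
    have l1 := card_le_of_mem_chains hb'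
    have l2 := card_le_of_mem_chains ha'
    have k1 := Finset.card_le_card (Finset.filter_subset_filter (· ⊂ M) hce)
    have k2 := Finset.card_le_card (Finset.filter_subset_filter (M ⊂ ·) hce)
    dsimp only
    rw [show e.card - c.card = ((e.filter (· ⊂ M)).card - (c.filter (· ⊂ M)).card) +
        ((e.filter (M ⊂ ·)).card - (c.filter (M ⊂ ·)).card) by omega,
      show U.card - L.card - 1 - e.card = (M.card - L.card - 1 - (e.filter (· ⊂ M)).card) +
        (U.card - M.card - 1 - (e.filter (M ⊂ ·)).card) by omega, pow_add, pow_add]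
    ring

/-- Sorting the nonempty chains by their largest member. -/
lemma linkPoly_chains_empty (L U : Finset β) :
    linkPoly (chains L U) (U.card - L.card - 1) ∅ = (1 - X) ^ (U.card - L.card - 1) +
      X * ∑ T ∈ Finset.Ioo L U, (1 - X) ^ (U.card - T.card - 1) *
        linkPoly (chains L T) (T.card - L.card - 1) ∅ := by
  have hempty : ∅ ∈ chains L U := mem_chains.mpr ⟨by simp, by simp⟩
  have hempty' : ∀ T, ∅ ∈ chains T U := fun T => mem_chains.mpr ⟨by simp, by simp⟩
  simp only [linkPoly, Finset.empty_subset, Finset.filter_true, Finset.card_empty, Nat.sub_zero]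
  rw [← Finset.add_sum_erase _ _ hempty]
  congr 1
  · simp
  simp only [Finset.mul_sum]
  rw [Finset.sum_sigma']
  symm
  refine Finset.sum_bij (fun p _ => insert p.1 (p.2 ∪ ∅)) ?_ ?_ ?_ ?_
  · rintro ⟨T, c⟩ hp
    simp only [Finset.mem_sigma, Finset.mem_Ioo] at hp
    rw [Finset.mem_erase]
    exact ⟨(Finset.insert_nonempty _ _).ne_empty,
      union_mem_chains hp.1.1 hp.1.2 hp.2 (hempty' T)⟩
  · rintro ⟨T, c⟩ hp ⟨T', c'⟩ hp' heq
    simp only [Finset.mem_sigma, Finset.mem_Ioo] at hp hp'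
    dsimp only at heq
    have hT : T = T' := by
      have h1 : T ∈ insert T' (c' ∪ ∅) := heq ▸ Finset.mem_insert_self _ _
      have h2 : T' ∈ insert T (c ∪ ∅) := heq ▸ Finset.mem_insert_self _ _
      rw [Finset.union_empty, Finset.mem_insert] at h1 h2
      rcases h1 with h1 | h1
      · exact h1
      rcases h2 with h2 | h2
      · exact h2.symm
      exact absurd ((mem_chains.mp hp'.2).1 T h1).2 ((mem_chains.mp hp.2).1 T' h2).2.asymm
    subst hT
    have := congrArg (fun e : Finset (Finset β) => e.filter (· ⊂ T)) heq
    simp only [filter_below_union hp.2 (hempty' T), filter_below_union hp'.2 (hempty' T)] at this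
    rw [this]
  · intro e he
    obtain ⟨hne, he⟩ := Finset.mem_erase.mp he
    obtain ⟨T, hT, hmax⟩ := e.exists_max_image Finset.card (Finset.nonempty_iff_ne_empty.mpr hne)
    have habove : e.filter (T ⊂ ·) = ∅ := by
      rw [Finset.filter_eq_empty_iff]
      exact fun s hs hTs => absurd (hmax s hs) (not_le.mpr (Finset.card_lt_card hTs))
    refine ⟨⟨T, e.filter (· ⊂ T)⟩, ?_, ?_⟩
    · simp only [Finset.mem_sigma, Finset.mem_Ioo]
      exact ⟨(mem_chains.mp he).1 T hT, filter_below_mem_chains he⟩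
    · have := insert_filter_union_filter he hT
      rwa [habove] at this
  · rintro ⟨T, c⟩ hp
    simp only [Finset.mem_sigma, Finset.mem_Ioo] at hp
    have hcard := card_insert_union hp.2 (hempty' T)
    have hle := card_le_of_mem_chains hp.2
    have hd := card_add_card_add_one hp.1.1 hp.1.2
    dsimp only
    rw [hcard, Finset.card_empty, add_zero, show U.card - L.card - 1 - (c.card + 1) =
      (U.card - T.card - 1) + (T.card - L.card - 1 - c.card) by omega, pow_add, pow_succ]
    ring

lemma sum_Ioo_card {L U : Finset β} (hLU : L ⊂ U) {n : ℕ} (hn : U.card = L.card + n + 1)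
    {M : Type*} [CommRing M] (f : ℕ → M) :
    ∑ T ∈ Finset.Ioo L U, f (T.card - L.card - 1) =
      ∑ k ∈ Finset.range n, ((n + 1).choose (k + 1) : M) * f k := by
  have hsub := hLU.subset
  have hcard : (U \ L).card = n + 1 := by
    rw [Finset.card_sdiff_of_subset hsub]; omega
  have h1 : ∑ T ∈ Finset.Ioo L U, f (T.card - L.card - 1) =
      ∑ A ∈ (U \ L).powerset.filter (fun A => A.card - 1 < n ∧ A.card ≠ 0), f (A.card - 1) := by
    refine Finset.sum_bij' (fun T _ => T \ L) (fun A _ => L ∪ A) ?_ ?_ ?_ ?_ ?_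
    · intro T hT
      obtain ⟨hLT, hTU⟩ := Finset.mem_Ioo.mp hT
      have h1 := Finset.card_lt_card hLT
      have h2 := Finset.card_lt_card hTU
      have h3 := Finset.card_sdiff_of_subset hLT.subset
      rw [Finset.mem_filter, Finset.mem_powerset]
      exact ⟨Finset.sdiff_subset_sdiff hTU.subset le_rfl, by omega, by omega⟩
    · intro A hA
      rw [Finset.mem_filter, Finset.mem_powerset] at hA
      have hdisj : Disjoint L A := Finset.disjoint_sdiff.mono_right hA.1
      have h3 := Finset.card_union_of_disjoint hdisj
      rw [Finset.mem_Ioo]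
      constructor
      · refine Finset.subset_union_left.ssubset_of_ne fun h => ?_
        rw [← h] at h3
        omega
      · refine (Finset.union_subset hsub (hA.1.trans Finset.sdiff_subset)).ssubset_of_ne fun h => ?_
        rw [h] at h3
        omega
    · intro T hT
      exact Finset.union_sdiff_of_subset (Finset.mem_Ioo.mp hT).1.subset
    · intro A hA
      rw [Finset.mem_filter, Finset.mem_powerset] at hA
      exact Finset.union_sdiff_cancel_left (Finset.disjoint_sdiff.mono_right hA.1)
    · intro T hT
      rw [Finset.card_sdiff_of_subset (Finset.mem_Ioo.mp hT).1.subset]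
  rw [h1, ← Finset.sum_fiberwise_of_maps_to (t := Finset.range n) (g := fun A => A.card - 1)]
  · refine Finset.sum_congr rfl fun k hk => ?_
    rw [Finset.mem_range] at hk
    rw [Finset.sum_congr rfl (g := fun _ => f k)
      (fun A hA => by rw [(Finset.mem_filter.mp hA).2]), Finset.sum_const, nsmul_eq_mul,
      ← hcard, ← Finset.card_powersetCard]
    congr 2
    congr 1
    ext A
    simp only [Finset.mem_filter, Finset.mem_powerset, Finset.mem_powersetCard]
    constructor
    · rintro ⟨⟨h, -, h2⟩, h3⟩
      exact ⟨h, by omega⟩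
    · rintro ⟨h, h2⟩
      exact ⟨⟨h, by omega, by omega⟩, by omega⟩
  · intro A hA
    exact Finset.mem_range.mpr (Finset.mem_filter.mp hA).2.1

/-- The barycentric subdivision of the boundary of a simplex has an Eulerian polynomial
as its `h`-polynomial. -/
lemma linkPoly_chains_eq_eulerianPoly (n : ℕ) : ∀ {L U : Finset β}, L ⊂ U →
    U.card = L.card + n + 1 → linkPoly (chains L U) n ∅ = eulerianPoly n := by
  induction n using Nat.strong_induction_on with
  | _ n ih =>
    intro L U hLU hn
    have h := linkPoly_chains_empty L U
    rw [show U.card - L.card - 1 = n by omega] at h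
    rw [h, eulerianPoly_binomial, ← sum_Ioo_card hLU hn
      (fun k => (1 - X) ^ (n - 1 - k) * eulerianPoly k)]
    refine congrArg (fun p => (1 - X) ^ n + X * p) (Finset.sum_congr rfl fun T hT => ?_)
    obtain ⟨hLT, hTU⟩ := Finset.mem_Ioo.mp hT
    have h1 := Finset.card_lt_card hLT
    have h2 := Finset.card_lt_card hTU
    rw [ih (T.card - L.card - 1) (by omega) hLT (by omega),
      show U.card - T.card - 1 = n - 1 - (T.card - L.card - 1) by omega]

lemma gammaCentered_linkPoly_chains {L U : Finset β} (hLU : L ⊂ U) {c : Finset (Finset β)}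
    (hc : c ∈ chains L U) : GammaCentered (U.card - L.card - 1 - c.card)
      (linkPoly (chains L U) (U.card - L.card - 1) c) := by
  induction hk : c.card using Nat.strong_induction_on generalizing L U c with
  | _ k ih =>
    subst hk
    rcases c.eq_empty_or_nonempty with rfl | ⟨M, hM⟩
    · have := Finset.card_lt_card hLU
      rw [linkPoly_chains_eq_eulerianPoly _ hLU (by omega), Finset.card_empty, Nat.sub_zero]
      exact gammaCentered_eulerianPoly _
    · obtain ⟨hLM, hMU⟩ := (mem_chains.mp hc).1 M hM
      have hb := filter_below_mem_chains (M := M) hc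
      have ha := filter_above_mem_chains (M := M) hc
      have hcc := card_insert_union hb ha
      rw [insert_filter_union_filter hc hM] at hcc
      have hd := card_add_card_add_one hLM hMU
      have l1 := card_le_of_mem_chains hb
      have l2 := card_le_of_mem_chains ha
      rw [linkPoly_chains_mul hc hM, show U.card - L.card - 1 - c.card =
        (M.card - L.card - 1 - (c.filter (· ⊂ M)).card) +
        (U.card - M.card - 1 - (c.filter (M ⊂ ·)).card) by omega]
      exact (ih _ (by omega) hLM hb rfl).mul (ih _ (by omega) hMU ha rfl)

end Links

/-! ### Complexes all of whose links have `γ`-positive `h`-polynomial -/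

section GammaLinks

/-- The finite family `D` of faces, the empty one included, has dimension `d - 1`, and
the `h`-polynomial of the link of each face is `γ`-positive with the centre of symmetry of a
sphere of complementary dimension. -/
structure GammaLinks {α : Type*} [DecidableEq α] (D : Finset (Finset α)) (d : ℕ) : Prop where
  card_le : ∀ F ∈ D, F.card ≤ d
  exists_card_eq : ∃ F ∈ D, F.card = d
  gammaCentered : ∀ F ∈ D, GammaCentered (d - F.card) (linkPoly D d F)

/-- The signs with which the `i`-th coordinate axis occurs in a set of vertices of the
cross-polytope. -/
def signsAt {n : ℕ} (s : Finset (Σ _ : Fin n, Bool)) (i : Fin n) : Finset Bool :=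
  s.preimage (fun b => (⟨i, b⟩ : Σ _ : Fin n, Bool))
    (sigma_mk_injective (β := fun _ : Fin n => Bool)).injOn

lemma mem_signsAt {n : ℕ} {s : Finset (Σ _ : Fin n, Bool)} {i : Fin n} {b : Bool} :
    b ∈ signsAt s i ↔ (⟨i, b⟩ : Σ _ : Fin n, Bool) ∈ s := Finset.mem_preimage

lemma signsAt_mono {n : ℕ} {s t : Finset (Σ _ : Fin n, Bool)} (h : s ⊆ t) (i : Fin n) :
    signsAt s i ⊆ signsAt t i := fun _ hb => mem_signsAt.mpr (h (mem_signsAt.mp hb))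

/-- The faces of the boundary of the cross-polytope. -/
def crossFaces (n : ℕ) : Finset (Finset (Σ _ : Fin n, Bool)) :=
  Finset.univ.filter fun s =>
    ∀ i, signsAt s i ≠ Finset.univ

lemma mem_crossFaces {n : ℕ} {s : Finset (Σ _ : Fin n, Bool)} :
    s ∈ crossFaces n ↔ s = ∅ ∨ s ∈ (crossPolytopeBoundary n).faces := by
  have hface : s ∈ (crossPolytopeBoundary n).faces ↔ s.Nonempty ∧ ∀ i,
      signsAt s i = ∅ ∨
        (signsAt s i).Nonempty ∧
          signsAt s i ≠ Finset.univ := Iff.rfl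
  rw [hface, crossFaces, Finset.mem_filter]
  constructor
  · rintro ⟨-, h⟩
    rcases s.eq_empty_or_nonempty with h0 | h0
    · exact Or.inl h0
    · exact Or.inr ⟨h0, fun i => (Finset.eq_empty_or_nonempty _).imp_right fun h1 => ⟨h1, h i⟩⟩
  · rintro (rfl | ⟨-, h⟩)
    · refine ⟨Finset.mem_univ _, fun i hi => ?_⟩
      have h : true ∈ signsAt ∅ i := hi ▸ Finset.mem_univ _
      simp [mem_signsAt] at h
    · refine ⟨Finset.mem_univ _, fun i hi => ?_⟩
      rcases h i with h1 | h1
      · rw [hi] at h1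
        exact Finset.univ_nonempty.ne_empty h1
      · exact h1.2 hi

lemma sigma_signsAt {n : ℕ} (s : Finset (Σ _ : Fin n, Bool)) :
    (Finset.univ.sigma fun i => signsAt s i) = s := by
  ext ⟨i, b⟩
  simp [mem_signsAt]

lemma card_eq_sum_card_signsAt {n : ℕ} (s : Finset (Σ _ : Fin n, Bool)) :
    s.card = ∑ i, (signsAt s i).card := by
  conv_lhs => rw [← sigma_signsAt s]
  rw [Finset.card_sigma]

lemma card_le_one_of_ne_univ {t : Finset Bool} (ht : t ≠ Finset.univ) : t.card ≤ 1 := by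
  have := (Finset.card_lt_iff_ne_univ t).mpr ht
  rw [Fintype.card_bool] at this
  omega

lemma card_le_of_mem_crossFaces {n : ℕ} {s : Finset (Σ _ : Fin n, Bool)} (hs : s ∈ crossFaces n) :
    s.card ≤ n := by
  rw [card_eq_sum_card_signsAt]
  refine (Finset.sum_le_sum fun i _ =>
    card_le_one_of_ne_univ ((Finset.mem_filter.mp hs).2 i)).trans ?_
  simp

/-- The contribution of a single zero-dimensional sphere to the `h`-polynomial of a link. -/
lemma linkPoly_twoPoints {t : Finset Bool} (ht : t ≠ Finset.univ) :
    ∑ r ∈ Finset.univ.filter (fun r : Finset Bool => r ≠ Finset.univ ∧ t ⊆ r),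
      (X : ℝ[X]) ^ (r.card - t.card) * (1 - X) ^ (1 - r.card) = (1 + X) ^ (1 - t.card) := by
  have key : ∀ t : Finset Bool, t ≠ Finset.univ →
      (t = ∅ ∧ Finset.univ.filter (fun r : Finset Bool => r ≠ Finset.univ ∧ t ⊆ r) =
        {∅, {true}, {false}}) ∨
      (t.card = 1 ∧ Finset.univ.filter (fun r : Finset Bool => r ≠ Finset.univ ∧ t ⊆ r) = {t}) := by
    decide
  rcases key t ht with ⟨rfl, h⟩ | ⟨hc, h⟩
  · rw [h, Finset.sum_insert (by decide), Finset.sum_pair (by decide)]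
    simp
  · rw [h, Finset.sum_singleton, hc]
    simp

lemma linkPoly_crossFaces {n : ℕ} {F : Finset (Σ _ : Fin n, Bool)} (hF : F ∈ crossFaces n) :
    linkPoly (crossFaces n) n F = (1 + X) ^ (n - F.card) := by
  have hpF : ∀ i, signsAt F i ≠ Finset.univ := (Finset.mem_filter.mp hF).2
  have h1 : ∑ f ∈ Fintype.piFinset fun i => Finset.univ.filter
        (fun r : Finset Bool => r ≠ Finset.univ ∧ signsAt F i ⊆ r),
      ∏ i, (X : ℝ[X]) ^ ((f i).card - (signsAt F i).card) * (1 - X) ^ (1 - (f i).card) =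
      (1 + X) ^ (n - F.card) := by
    rw [← Finset.prod_univ_sum _ fun i (r : Finset Bool) =>
      (X : ℝ[X]) ^ (r.card - (signsAt F i).card) * (1 - X) ^ (1 - r.card)]
    rw [Finset.prod_congr rfl fun i _ => linkPoly_twoPoints (hpF i), Finset.prod_pow_eq_pow_sum,
      Finset.sum_tsub_distrib _ fun i _ => card_le_one_of_ne_univ (hpF i),
      card_eq_sum_card_signsAt]
    simp
  rw [← h1, linkPoly]
  refine Finset.sum_bij' (fun s _ => signsAt s) (fun f _ => Finset.univ.sigma f) ?_ ?_ ?_ ?_ ?_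
  · intro s hs
    obtain ⟨hs, hFs⟩ := Finset.mem_filter.mp hs
    rw [Fintype.mem_piFinset]
    intro i
    exact Finset.mem_filter.mpr
      ⟨Finset.mem_univ _, (Finset.mem_filter.mp hs).2 i, signsAt_mono hFs i⟩
  · intro f hf
    rw [Fintype.mem_piFinset] at hf
    refine Finset.mem_filter.mpr ⟨Finset.mem_filter.mpr ⟨Finset.mem_univ _, fun i => ?_⟩, ?_⟩
    · have := (Finset.mem_filter.mp (hf i)).2.1
      convert this using 1
      ext b
      simp [mem_signsAt]
    · rintro ⟨i, b⟩ hb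
      have := (Finset.mem_filter.mp (hf i)).2.2
      rw [Finset.mem_sigma]
      exact ⟨Finset.mem_univ _, this (mem_signsAt.mpr hb)⟩
  · intro s _
    exact sigma_signsAt s
  · intro f _
    ext i b
    simp [mem_signsAt]
  · intro s hs
    obtain ⟨hs, hFs⟩ := Finset.mem_filter.mp hs
    have hps : ∀ i, signsAt s i ≠ Finset.univ := (Finset.mem_filter.mp hs).2
    have hle : ∀ i, signsAt F i ⊆ signsAt s i := signsAt_mono hFs
    rw [Finset.prod_mul_distrib, Finset.prod_pow_eq_pow_sum, Finset.prod_pow_eq_pow_sum,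
      Finset.sum_tsub_distrib _ fun i _ => card_le_one_of_ne_univ (hps i),
      Finset.sum_tsub_distrib _ fun i _ => Finset.card_le_card (hle i),
      card_eq_sum_card_signsAt s, card_eq_sum_card_signsAt F]
    simp

lemma gammaLinks_crossFaces (n : ℕ) : GammaLinks (crossFaces n) n where
  card_le _ := card_le_of_mem_crossFaces
  exists_card_eq := by
    refine ⟨Finset.univ.sigma fun _ => {true}, ?_, by simp⟩
    refine Finset.mem_filter.mpr ⟨Finset.mem_univ _, fun i h => ?_⟩
    have : false ∈ (Finset.univ : Finset Bool) := Finset.mem_univ _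
    rw [← h, mem_signsAt] at this
    simp at this
  gammaCentered F hF := by
    rw [linkPoly_crossFaces hF]
    exact GammaCentered.one_add_X_pow _

lemma mem_chains_iff_barycentricSubdivision {n : ℕ} {c : Finset (Finset (Fin (n + 1)))} :
    c ∈ chains ∅ Finset.univ ↔
      c = ∅ ∨ c ∈ (barycentricSubdivision (simplexBoundary (Fin (n + 1)))).faces := by
  have hface : c ∈ (barycentricSubdivision (simplexBoundary (Fin (n + 1)))).faces ↔
      c.Nonempty ∧ (∀ s ∈ c, s.Nonempty ∧ s ≠ Finset.univ) ∧
        IsChain (· ⊆ ·) (c : Set (Finset (Fin (n + 1)))) := Iff.rfl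
  rw [hface, mem_chains]
  simp only [Finset.empty_ssubset, Finset.ssubset_univ_iff]
  rcases c.eq_empty_or_nonempty with rfl | h
  · simp
  · simp [h, h.ne_empty]

lemma gammaLinks_chains (n : ℕ) :
    GammaLinks (chains (∅ : Finset (Fin (n + 1))) Finset.univ) n where
  card_le F hF := by simpa using card_le_of_mem_chains hF
  exists_card_eq := by
    let f : Fin n → Finset (Fin (n + 1)) := fun k => Finset.univ.filter fun i => i ≤ k.castSucc
    have hmono : StrictMono f := by
      intro k l hkl
      refine Finset.ssubset_iff_subset_ne.mpr ⟨fun i hi => ?_, fun h => ?_⟩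
      · simp only [f, Finset.mem_filter, Finset.mem_univ, true_and] at hi ⊢
        exact hi.trans (Fin.castSucc_lt_castSucc_iff.mpr hkl).le
      · have : l.castSucc ∈ f k := by rw [h]; simp [f]
        simp only [f, Finset.mem_filter, Finset.mem_univ, true_and] at this
        exact absurd hkl (not_lt.mpr (Fin.castSucc_le_castSucc_iff.mp this))
    refine ⟨Finset.univ.image f, mem_chains.mpr ⟨?_, ?_⟩, ?_⟩
    · intro s hs
      obtain ⟨k, -, rfl⟩ := Finset.mem_image.mp hs
      rw [Finset.empty_ssubset, Finset.ssubset_univ_iff]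
      refine ⟨⟨k.castSucc, by simp [f]⟩, fun h => ?_⟩
      have : Fin.last n ∈ f k := h ▸ Finset.mem_univ _
      simp only [f, Finset.mem_filter, Finset.mem_univ, true_and] at this
      exact absurd (Fin.castSucc_lt_last k) (not_lt.mpr this)
    · intro s hs t ht _
      simp only [Finset.coe_image, Finset.coe_univ, Set.image_univ, Set.mem_range] at hs ht
      obtain ⟨k, rfl⟩ := hs
      obtain ⟨l, rfl⟩ := ht
      exact (le_total k l).imp (fun h => hmono.monotone h) fun h => hmono.monotone h
    · rw [Finset.card_image_of_injective _ hmono.injective, Finset.card_univ, Fintype.card_fin]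
  gammaCentered F hF := by
    have := gammaCentered_linkPoly_chains (Finset.empty_ssubset.mpr Finset.univ_nonempty) hF
    simpa using this

/-- The property is invariant under relabelling the vertices. -/
lemma GammaLinks.image {α β : Type*} [DecidableEq α] [DecidableEq β] {D : Finset (Finset α)}
    {d : ℕ} (h : GammaLinks D d) (φ : α → β) {A : Set α} (hφ : Set.InjOn φ A)
    (hA : ∀ s ∈ D, (s : Set α) ⊆ A) : GammaLinks (D.image (Finset.image φ)) d := by
  have hcard : ∀ s ∈ D, (s.image φ).card = s.card := fun s hs =>
    Finset.card_image_of_injOn (hφ.mono (hA s hs))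
  have hsub : ∀ s ∈ D, ∀ t ∈ D, s.image φ ⊆ t.image φ → s ⊆ t := by
    intro s hs t ht hst v hv
    obtain ⟨w, hw, hwv⟩ := Finset.mem_image.mp (hst (Finset.mem_image_of_mem φ hv))
    rwa [← hφ (hA t ht hw) (hA s hs hv) hwv]
  have hinj : Set.InjOn (Finset.image φ) (D : Set (Finset α)) := fun s hs t ht hst =>
    (hsub s hs t ht hst.subset).antisymm (hsub t ht s hs hst.symm.subset)
  have hlink : ∀ s ∈ D, linkPoly (D.image (Finset.image φ)) d (s.image φ) = linkPoly D d s := by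
    intro s hs
    rw [linkPoly, linkPoly, Finset.sum_filter, Finset.sum_image hinj, Finset.sum_filter]
    refine Finset.sum_congr rfl fun t ht => ?_
    rw [hcard s hs, hcard t ht]
    exact if_congr ⟨hsub s hs t ht, Finset.image_subset_image⟩ rfl rfl
  obtain ⟨s, hs, hsd⟩ := h.exists_card_eq
  refine ⟨?_, ⟨s.image φ, Finset.mem_image_of_mem _ hs, (hcard s hs).trans hsd⟩, ?_⟩
  · intro F hF
    obtain ⟨s, hs, rfl⟩ := Finset.mem_image.mp hF
    exact (hcard s hs).le.trans (h.card_le s hs)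
  · intro F hF
    obtain ⟨s, hs, rfl⟩ := Finset.mem_image.mp hF
    rw [hlink s hs, hcard s hs]
    exact h.gammaCentered s hs

lemma IsRealization.exists_gammaLinks {α E : Type*} [AddCommGroup E] [Module ℝ E] [DecidableEq α]
    [DecidableEq E] {Δ : Geometry.SimplicialComplex ℝ E} {K : PreAbstractSimplicialComplex α}
    (hΔ : IsRealization Δ K) {DK : Finset (Finset α)} (hDK : ∀ s, s ∈ DK ↔ s = ∅ ∨ s ∈ K.faces)
    {d : ℕ} (h : GammaLinks DK d) :
    ∃ D : Finset (Finset E), (∀ s, s ∈ D ↔ s = ∅ ∨ s ∈ Δ.faces) ∧ GammaLinks D d := by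
  obtain ⟨φ, hφ, hfaces⟩ := hΔ
  refine ⟨DK.image (Finset.image φ), fun s => ?_, h.image φ hφ fun s hs v hv => ?_⟩
  · rw [Finset.mem_image, hfaces]
    constructor
    · rintro ⟨t, ht, rfl⟩
      rcases (hDK t).mp ht with rfl | ht
      · exact Or.inl rfl
      · exact Or.inr ⟨t, ht, by simp⟩
    · rintro (rfl | ⟨t, ht, hst⟩)
      · exact ⟨∅, (hDK ∅).mpr (Or.inl rfl), rfl⟩
      · exact ⟨t, (hDK t).mpr (Or.inr ht), Finset.coe_injective (by simp [hst])⟩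
  · rcases (hDK s).mp hs with rfl | hs
    · simp at hv
    · exact (K.isRelLowerSet_faces hs).2 (Finset.singleton_subset_iff.mpr hv)
        (Finset.singleton_nonempty v)

end GammaLinks

/-! ### Decomposition of the `h`-polynomial into local contributions -/

section Decomposition

variable {α : Type*} [DecidableEq α]

/-- Powers of variables under the convolution of the Boolean lattice. -/
lemma sum_powerset_convolution {R : Type*} [CommRing R] (H : Finset α → R) (y z : R)
    (F : Finset α) :
    ∑ G ∈ F.powerset, z ^ (F.card - G.card) * ∑ K ∈ G.powerset, H K * y ^ (G.card - K.card) =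
      ∑ K ∈ F.powerset, H K * (y + z) ^ (F.card - K.card) := by
  simp_rw [Finset.mul_sum]
  rw [Finset.sum_comm' (t' := F.powerset) (s' := fun K => Finset.Icc K F)]
  · refine Finset.sum_congr rfl fun K hK => ?_
    rw [← sum_Icc_pow_mul_pow y z (Finset.mem_powerset.mp hK), Finset.mul_sum]
    exact Finset.sum_congr rfl fun G _ => by ring
  · intro G K
    simp only [Finset.mem_powerset, Finset.mem_Icc]
    exact ⟨fun h => ⟨⟨h.2, h.1⟩, h.2.trans h.1⟩, fun h => ⟨h.1.2, h.1.1⟩⟩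

/-- The `h`-polynomial of the subcomplex of the faces carried by subsets of `F`; `c` assigns
to a face its carrier. -/
def carriedPoly (T : Finset (Finset α)) (c : Finset α → Finset α) (F : Finset α) : ℝ[X] :=
  ∑ s ∈ T.filter (c · ⊆ F), X ^ s.card * (1 - X) ^ (F.card - s.card)

/-- The `h`-polynomial of the set of the faces with carrier `F`. -/
def interiorPoly (T : Finset (Finset α)) (c : Finset α → Finset α) (F : Finset α) : ℝ[X] :=
  ∑ s ∈ T.filter (c · = F), X ^ s.card * (1 - X) ^ (F.card - s.card)

/-- The local `h`-polynomial, in terms of carriers. -/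
def localPoly (T : Finset (Finset α)) (c : Finset α → Finset α) (F : Finset α) : ℝ[X] :=
  ∑ G ∈ F.powerset, (-1) ^ (F.card - G.card) * carriedPoly T c G

variable {T D : Finset (Finset α)} {c : Finset α → Finset α}

lemma sum_eq_sum_interiorPoly (hc : ∀ s ∈ T, s.card ≤ (c s).card) {S : Finset (Finset α)}
    {P : Finset α → Prop} [DecidablePred P] (hS : ∀ s ∈ T, P s ↔ c s ∈ S) {d : ℕ}
    (hd : ∀ F ∈ S, F.card ≤ d) :
    ∑ s ∈ T.filter P, (X : ℝ[X]) ^ s.card * (1 - X) ^ (d - s.card) =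
      ∑ F ∈ S, interiorPoly T c F * (1 - X) ^ (d - F.card) := by
  rw [← Finset.sum_fiberwise_of_maps_to (t := S) (g := c)
    (fun s hs => (hS s (Finset.mem_filter.mp hs).1).mp (Finset.mem_filter.mp hs).2)]
  refine Finset.sum_congr rfl fun F hF => ?_
  have hfilter : (T.filter P).filter (c · = F) = T.filter (c · = F) := by
    ext s
    simp only [Finset.mem_filter]
    constructor
    · exact fun h => ⟨h.1.1, h.2⟩
    · exact fun h => ⟨⟨h.1, (hS s h.1).mpr (h.2 ▸ hF)⟩, h.2⟩
  rw [hfilter, interiorPoly, Finset.sum_mul]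
  refine Finset.sum_congr rfl fun s hs => ?_
  obtain ⟨hsT, rfl⟩ := Finset.mem_filter.mp hs
  have h1 := hc s hsT
  have h2 := hd _ hF
  rw [mul_assoc, ← pow_add]
  congr 2
  omega

lemma carriedPoly_eq (hc : ∀ s ∈ T, s.card ≤ (c s).card) (F : Finset α) :
    carriedPoly T c F = ∑ G ∈ F.powerset, interiorPoly T c G * (1 - X) ^ (F.card - G.card) :=
  sum_eq_sum_interiorPoly hc (by simp) fun _ hG => Finset.card_le_card (Finset.mem_powerset.mp hG)

lemma localPoly_eq (hc : ∀ s ∈ T, s.card ≤ (c s).card) (F : Finset α) :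
    localPoly T c F = ∑ G ∈ F.powerset, interiorPoly T c G * (-X) ^ (F.card - G.card) := by
  rw [localPoly, Finset.sum_congr rfl fun G _ => by rw [carriedPoly_eq hc],
    sum_powerset_convolution,
    show (1 - X + -1 : ℝ[X]) = -X by ring]

lemma interiorPoly_eq (hc : ∀ s ∈ T, s.card ≤ (c s).card) (F : Finset α) :
    interiorPoly T c F = ∑ G ∈ F.powerset, X ^ (F.card - G.card) * localPoly T c G := by
  rw [Finset.sum_congr rfl fun G _ => by rw [localPoly_eq hc], sum_powerset_convolution,
    Finset.sum_eq_single F]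
  · simp
  · intro G hG hne
    have := Finset.card_lt_card ((Finset.mem_powerset.mp hG).ssubset_of_ne hne)
    rw [neg_add_cancel, zero_pow (by omega), mul_zero]
  · simp

/-- The `h`-polynomial of a subdivision as a combination of the `h`-polynomials of links, with
the local `h`-polynomials as coefficients. -/
lemma sum_eq_sum_localPoly_mul_linkPoly (hc : ∀ s ∈ T, s.card ≤ (c s).card)
    (hD : ∀ s ∈ T, c s ∈ D) (hlower : ∀ F ∈ D, ∀ G ⊆ F, G ∈ D) {d : ℕ}
    (hd : ∀ F ∈ D, F.card ≤ d) :
    ∑ s ∈ T, (X : ℝ[X]) ^ s.card * (1 - X) ^ (d - s.card) =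
      ∑ F ∈ D, localPoly T c F * linkPoly D d F := by
  have h := sum_eq_sum_interiorPoly hc (P := fun _ => True) (by simpa using hD) hd
  rw [Finset.filter_true] at h
  simp_rw [h, interiorPoly_eq hc, linkPoly, Finset.sum_mul, Finset.mul_sum]
  rw [Finset.sum_comm' (t' := D) (s' := fun G => D.filter (G ⊆ ·))]
  · exact Finset.sum_congr rfl fun F _ => Finset.sum_congr rfl fun G _ => by ring
  · intro F G
    simp only [Finset.mem_powerset, Finset.mem_filter]
    exact ⟨fun h => ⟨⟨h.1, h.2⟩, hlower F h.1 G h.2⟩, fun h => ⟨h.1.1, h.1.2⟩⟩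

/-- Reciprocity between `h`-polynomials and those of the interiors makes the local
`h`-polynomial palindromic. -/
lemma localPoly_eval_inv (hc : ∀ s ∈ T, s.card ≤ (c s).card) {F : Finset α} {x : ℝ}
    (hrec : ∀ G ⊆ F, x ^ G.card * (carriedPoly T c G).eval x⁻¹ = (interiorPoly T c G).eval x) :
    x ^ F.card * (localPoly T c F).eval x⁻¹ = (localPoly T c F).eval x := by
  conv_rhs => rw [localPoly_eq hc]
  rw [localPoly]
  simp only [eval_finsetSum, Finset.mul_sum]
  refine Finset.sum_congr rfl fun G hG => ?_
  have hGF := Finset.mem_powerset.mp hG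
  have hle := Finset.card_le_card hGF
  rw [eval_mul, eval_mul, ← hrec G hGF]
  simp only [eval_pow, eval_neg, eval_one, eval_X]
  rw [neg_pow x, ← Nat.sub_add_cancel hle, pow_add, Nat.add_sub_cancel]
  ring

/-- If local `h`-polynomials and `h`-polynomials of links are `γ`-positive, so is
the `h`-polynomial of the subdivision. -/
theorem gammaCentered_of_localPoly (hc : ∀ s ∈ T, s.card ≤ (c s).card)
    (hD : ∀ s ∈ T, c s ∈ D) (hlower : ∀ F ∈ D, ∀ G ⊆ F, G ∈ D) {d : ℕ} (hlinks : GammaLinks D d)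
    (hrec : ∀ F ∈ D, ∀ x : ℝ, 0 < x →
      x ^ F.card * (carriedPoly T c F).eval x⁻¹ = (interiorPoly T c F).eval x)
    (hlocal : ∀ F ∈ D, IsGammaPositive (localPoly T c F)) :
    GammaCentered d (∑ s ∈ T, (X : ℝ[X]) ^ s.card * (1 - X) ^ (d - s.card)) := by
  rw [sum_eq_sum_localPoly_mul_linkPoly hc hD hlower hlinks.card_le]
  refine GammaCentered.sum fun F hF => ?_
  have h1 : GammaCentered F.card (localPoly T c F) := (hlocal F hF).gammaCentered fun x hx =>
    localPoly_eval_inv hc fun G hG => hrec G (hlower F hF G hG) x hx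
  have := h1.mul (hlinks.gammaCentered F hF)
  rwa [Nat.add_sub_cancel' (hlinks.card_le F hF)] at this

end Decomposition

/-! ### Geometric complexes and their cones -/

section Cones

variable {α V : Type*} [AddCommGroup V] [Module ℝ V] {ℓ : α → V}

lemma smul_mem_coneOn {s : Finset α} {q : V} (hq : q ∈ coneOn ℓ s) {m : ℝ} (hm : 0 ≤ m) :
    m • q ∈ coneOn ℓ s := by
  obtain ⟨a, ha, rfl⟩ := hq
  exact ⟨fun v => m * a v, fun v hv => mul_nonneg hm (ha v hv), by
    simp [Finset.smul_sum, mul_smul]⟩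

lemma zero_mem_coneOn (s : Finset α) : (0 : V) ∈ coneOn ℓ s := ⟨0, by simp, by simp⟩

lemma self_mem_coneOn {s : Finset α} {v : α} (hv : v ∈ s) : ℓ v ∈ coneOn ℓ s := by
  classical
  exact ⟨fun w => if w = v then 1 else 0, fun w _ => by dsimp only; split_ifs <;> norm_num, by
    simp [hv]⟩

lemma coneOn_mono {s t : Finset α} (h : s ⊆ t) : coneOn ℓ s ⊆ coneOn ℓ t := by
  rintro _ ⟨a, ha, rfl⟩
  exact coneOn_sum_mem ha fun v hv => self_mem_coneOn (h hv)

/-- Coordinates of a point in a face of a simplicial cone. -/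
lemma coord_of_sum_mem_coneOn {G H : Finset α} (hG : LinearIndepOn ℝ ℓ (G : Set α)) (hHG : H ⊆ G)
    {a : α → ℝ} (h : ∑ v ∈ G, a v • ℓ v ∈ coneOn ℓ H) : ∀ v ∈ G, v ∉ H → a v = 0 := by
  classical
  obtain ⟨b, -, hb⟩ := h
  intro v hv hvH
  have := eq_of_sum_smul_eq hG (a := a) (b := fun v => if v ∈ H then b v else 0) (by
    rw [← hb]
    simp only [ite_smul, zero_smul]
    rw [Finset.sum_ite_mem, Finset.inter_eq_right.mpr hHG]) v hv
  simpa [hvH] using this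

/-- A face of a simplicial cone is extreme: if it contains a positive combination of points of
the cone, then it contains each of them. -/
lemma mem_coneOn_of_sum_mem {G H : Finset α} (hG : LinearIndepOn ℝ ℓ (G : Set α)) (hHG : H ⊆ G)
    {s : Finset α} (hs : ∀ v ∈ s, ℓ v ∈ coneOn ℓ G) {a : α → ℝ} (ha : ∀ v ∈ s, 0 < a v)
    (h : ∑ v ∈ s, a v • ℓ v ∈ coneOn ℓ H) : ∀ v ∈ s, ℓ v ∈ coneOn ℓ H := by
  classical
  choose! b hb hbs using hs
  have hsum : ∑ v ∈ s, a v • ℓ v = ∑ u ∈ G, (∑ v ∈ s, a v * b v u) • ℓ u := by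
    simp_rw [Finset.sum_smul]
    rw [Finset.sum_comm]
    refine Finset.sum_congr rfl fun v hv => ?_
    conv_lhs => rw [← hbs v hv]
    simp [Finset.smul_sum, mul_smul]
  rw [hsum] at h
  have hzero := coord_of_sum_mem_coneOn hG hHG h
  intro v hv
  refine ⟨b v, fun u hu => hb v hv u (hHG hu), ?_⟩
  rw [← hbs v hv]
  refine Finset.sum_subset hHG fun u hu huH => ?_
  have h0 := (Finset.sum_eq_zero_iff_of_nonneg fun w hw =>
    mul_nonneg (ha w hw).le (hb w hw u hu)).mp (hzero u hu huH) v hv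
  rw [(mul_eq_zero.mp h0).resolve_left (ha v hv).ne', zero_smul]

end Cones

section Lift

variable {E : Type*} [AddCommGroup E] [Module ℝ E]

/-- Homogenization: the affine space `E` as the hyperplane at height `1` of `E × ℝ`. -/
def lift (v : E) : E × ℝ := (v, 1)

lemma fst_sum_lift (s : Finset E) (a : E → ℝ) : (∑ v ∈ s, a v • lift v).1 = ∑ v ∈ s, a v • v := by
  simp [lift, Prod.fst_sum]

lemma snd_sum_lift (s : Finset E) (a : E → ℝ) : (∑ v ∈ s, a v • lift v).2 = ∑ v ∈ s, a v := by
  simp [lift, Prod.snd_sum]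

lemma linearIndepOn_lift {s : Finset E} (h : AffineIndependent ℝ ((↑) : s → E)) :
    LinearIndepOn ℝ lift (s : Set E) := by
  rw [linearIndepOn_finset_iff]
  intro f hf
  refine h.eq_zero_of_sum_eq_zero_subtype ?_ ?_
  · rw [← snd_sum_lift, hf]; rfl
  · rw [← fst_sum_lift, hf]; rfl

lemma lift_mem_coneOn {s : Finset E} {x : E} :
    lift x ∈ coneOn lift s ↔ x ∈ convexHull ℝ (s : Set E) := by
  rw [Finset.mem_convexHull']
  refine exists_congr fun a => and_congr_right fun _ => ?_
  rw [Prod.ext_iff, fst_sum_lift, snd_sum_lift, and_comm]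
  rfl

lemma eq_zero_or_exists_lift {s : Finset E} {q : E × ℝ} (hq : q ∈ coneOn lift s) :
    q = 0 ∨ ∃ m > (0 : ℝ), ∃ x ∈ convexHull ℝ (s : Set E), q = m • lift x := by
  have hq' := hq
  obtain ⟨a, ha, rfl⟩ := hq'
  set q := ∑ v ∈ s, a v • lift v with hqdef
  have hsnd : q.2 = ∑ v ∈ s, a v := snd_sum_lift s a
  rcases (Finset.sum_nonneg ha).eq_or_lt with h0 | h0
  · left
    refine Finset.sum_eq_zero fun v hv => ?_
    rw [(Finset.sum_eq_zero_iff_of_nonneg ha).mp h0.symm v hv, zero_smul]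
  · right
    rw [← hsnd] at h0
    have hlift : lift (q.2⁻¹ • q.1) = q.2⁻¹ • q :=
      Prod.ext rfl (by simp [lift, inv_mul_cancel₀ h0.ne'])
    refine ⟨q.2, h0, q.2⁻¹ • q.1, ?_, ?_⟩
    · rw [← lift_mem_coneOn, hlift]
      exact smul_mem_coneOn hq (inv_nonneg.mpr h0.le)
    · rw [hlift, smul_smul, mul_inv_cancel₀ h0.ne', one_smul]

variable {K : Geometry.SimplicialComplex ℝ E}

lemma linearIndepOn_lift_of_face {s : Finset E} (hs : s = ∅ ∨ s ∈ K.faces) :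
    LinearIndepOn ℝ lift (s : Set E) := by
  rcases hs with rfl | hs
  · rw [Finset.coe_empty]
    exact linearIndepOn_empty ℝ lift
  · exact linearIndepOn_lift (K.indep hs)

lemma coneOn_inter_subset [DecidableEq E] {s t : Finset E} (hs : s = ∅ ∨ s ∈ K.faces)
    (ht : t = ∅ ∨ t ∈ K.faces) : coneOn lift s ∩ coneOn lift t ⊆ coneOn lift (s ∩ t) := by
  rintro q ⟨hqs, hqt⟩
  rcases eq_zero_or_exists_lift hqs with rfl | ⟨m, hm, x, hx, rfl⟩
  · exact zero_mem_coneOn _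
  · have hxt : x ∈ convexHull ℝ (t : Set E) := by
      rw [← lift_mem_coneOn]
      simpa [smul_smul, inv_mul_cancel₀ hm.ne'] using smul_mem_coneOn hqt (inv_nonneg.mpr hm.le)
    refine smul_mem_coneOn (lift_mem_coneOn.mpr ?_) hm.le
    rcases hs with rfl | hs
    · simp at hx
    rcases ht with rfl | ht
    · simp at hxt
    rw [Finset.coe_inter]
    exact K.inter_subset_convexHull hs ht ⟨hx, hxt⟩

lemma eq_of_sum_lift_eq {s t : Finset E} (hs : s = ∅ ∨ s ∈ K.faces)
    (ht : t = ∅ ∨ t ∈ K.faces) {a b : E → ℝ} (ha : ∀ v ∈ s, 0 < a v) (hb : ∀ v ∈ t, 0 < b v)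
    (hab : ∑ v ∈ s, a v • lift v = ∑ v ∈ t, b v • lift v) : s = t := by
  classical
  have hmem : ∑ v ∈ s, a v • lift v ∈ coneOn lift (s ∩ t) := by
    refine coneOn_inter_subset hs ht ⟨⟨a, fun v hv => (ha v hv).le, rfl⟩, ?_⟩
    rw [hab]
    exact ⟨b, fun v hv => (hb v hv).le, rfl⟩
  have h1 := coord_of_sum_mem_coneOn (ℓ := lift) (a := a) (H := s ∩ t)
    (linearIndepOn_lift_of_face hs) Finset.inter_subset_left hmem
  rw [hab] at hmem
  have h2 := coord_of_sum_mem_coneOn (ℓ := lift) (a := b) (H := s ∩ t)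
    (linearIndepOn_lift_of_face ht) Finset.inter_subset_right hmem
  refine Finset.Subset.antisymm (fun v hv => ?_) fun v hv => ?_
  · by_contra hvt
    exact (ha v hv).ne' (h1 v hv fun h => hvt (Finset.mem_inter.mp h).2)
  · by_contra hvs
    exact (hb v hv).ne' (h2 v hv fun h => hvs (Finset.mem_inter.mp h).1)

end Lift

/-! ### Triangulations -/

section Triangulation

variable {E : Type*} [AddCommGroup E] [Module ℝ E] [DecidableEq E]

/-- The carrier of a simplex of a triangulation: the smallest face containing it. -/
lemma IsTriangulation.exists_carrier {Δ Δ' : Geometry.SimplicialComplex ℝ E}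
    (hΔ : IsTriangulation Δ' Δ) {D : Finset (Finset E)} (hD : ∀ s, s ∈ D ↔ s = ∅ ∨ s ∈ Δ.faces)
    {s : Finset E} (hs : s = ∅ ∨ s ∈ Δ'.faces) :
    ∃ C ∈ D, ∀ F ∈ D, C ⊆ F ↔ (s : Set E) ⊆ convexHull ℝ (F : Set E) := by
  classical
  have hne : (D.filter fun F : Finset E => (s : Set E) ⊆ convexHull ℝ (F : Set E)).Nonempty := by
    rcases hs with rfl | hs
    · exact ⟨∅, Finset.mem_filter.mpr ⟨(hD ∅).mpr (Or.inl rfl), by simp⟩⟩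
    · obtain ⟨F, hF, hsF⟩ := hΔ.2.2 s hs
      exact ⟨F, Finset.mem_filter.mpr
        ⟨(hD F).mpr (Or.inr hF), (subset_convexHull ℝ _).trans hsF⟩⟩
  obtain ⟨C, hC, hmin⟩ := Finset.exists_min_image _ Finset.card hne
  obtain ⟨hCD, hsC⟩ := Finset.mem_filter.mp hC
  refine ⟨C, hCD, fun F hF => ⟨fun h => hsC.trans (convexHull_mono (Finset.coe_subset.mpr h)),
    fun hsF => ?_⟩⟩
  have hCF : C ∩ F ∈ D := by
    rw [hD]
    rcases (C ∩ F).eq_empty_or_nonempty with h0 | h0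
    · exact Or.inl h0
    · rcases (hD C).mp hCD with rfl | hC'
      · simp at h0
      · exact Or.inr (Δ.down_closed hC' Finset.inter_subset_left h0)
  have hle := hmin (C ∩ F) (Finset.mem_filter.mpr ⟨hCF, fun v hv => by
    rw [← lift_mem_coneOn]
    exact coneOn_inter_subset ((hD C).mp hCD) ((hD F).mp hF)
      ⟨lift_mem_coneOn.mpr (hsC hv), lift_mem_coneOn.mpr (hsF hv)⟩⟩)
  have := Finset.eq_of_subset_of_card_le Finset.inter_subset_left hle
  rw [← this]
  exact Finset.inter_subset_right

/-- The simplices of a triangulation that are contained in a given face subdivide the cone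
over that face. -/
lemma IsTriangulation.subdividesCone {Δ Δ' : Geometry.SimplicialComplex ℝ E}
    (hΔ : IsTriangulation Δ' Δ) {F : Finset E} (hF : F = ∅ ∨ F ∈ Δ.faces)
    {T : Finset (Finset E)} (hT : ∀ s, s ∈ T ↔
      (s = ∅ ∨ s ∈ Δ'.faces) ∧ (s : Set E) ⊆ convexHull ℝ (F : Set E)) :
    SubdividesCone lift T F where
  indep s hs := linearIndepOn_lift_of_face ((hT s).mp hs).1
  indep_base := linearIndepOn_lift_of_face hF
  down_closed s hs t hts := by
    obtain ⟨h1, h2⟩ := (hT s).mp hs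
    refine (hT t).mpr ⟨?_, (Finset.coe_subset.mpr hts).trans h2⟩
    rcases t.eq_empty_or_nonempty with h0 | h0
    · exact Or.inl h0
    · rcases h1 with rfl | h1
      · exact Or.inl (Finset.subset_empty.mp hts)
      · exact Or.inr (Δ'.down_closed h1 hts h0)
  eq_of_sum_eq s hs t ht a b ha hb hab :=
    eq_of_sum_lift_eq ((hT s).mp hs).1 ((hT t).mp ht).1 ha hb hab
  mem_cone s hs v hv := lift_mem_coneOn.mpr (((hT s).mp hs).2 hv)
  cover q hq := by
    rcases eq_zero_or_exists_lift hq with rfl | ⟨m, hm, x, hx, rfl⟩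
    · exact ⟨∅, (hT ∅).mpr ⟨Or.inl rfl, by simp⟩, zero_mem_coneOn _⟩
    have hF' : F ∈ Δ.faces := hF.resolve_left (by rintro rfl; simp at hx)
    have hxΔ : x ∈ Δ'.space := by
      rw [hΔ.2.1]
      exact Δ.convexHull_subset_space hF' hx
    obtain ⟨s, hs, hxs⟩ := Geometry.SimplicialComplex.mem_space_iff.mp hxΔ
    obtain ⟨a, ha, hsum⟩ := lift_mem_coneOn.mpr hxs
    obtain ⟨G, hG, hsG⟩ := hΔ.2.2 s hs
    -- The simplex whose relative interior contains `x` lies in `F`, as `G ∩ F` is extreme in `G`.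
    set r := s.filter fun v => 0 < a v with hr
    have hrsum : ∑ v ∈ r, a v • lift v = lift x := by
      rw [← hsum, hr, Finset.sum_filter_of_ne]
      intro v hv hne
      exact lt_of_le_of_ne (ha v hv) fun h0 => hne (by rw [← h0, zero_smul])
    have hrpos : ∀ v ∈ r, 0 < a v := fun v hv => (Finset.mem_filter.mp hv).2
    have hrG : ∀ v ∈ r, lift v ∈ coneOn lift G := fun v hv =>
      lift_mem_coneOn.mpr (hsG (subset_convexHull ℝ _ (Finset.mem_filter.mp hv).1))
    have hxGF : lift x ∈ coneOn lift (G ∩ F) := by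
      refine coneOn_inter_subset (K := Δ) (Or.inr hG) (Or.inr hF') ⟨?_, lift_mem_coneOn.mpr hx⟩
      rw [← hrsum]
      exact coneOn_sum_mem (fun v hv => (hrpos v hv).le) hrG
    rw [← hrsum] at hxGF
    have hrF := mem_coneOn_of_sum_mem (ℓ := lift) (a := a) (H := G ∩ F)
      (linearIndepOn_lift (Δ.indep hG)) Finset.inter_subset_left hrG hrpos hxGF
    refine ⟨r, (hT r).mpr ⟨?_, fun v hv => ?_⟩, smul_mem_coneOn ?_ hm.le⟩
    · rcases r.eq_empty_or_nonempty with h0 | h0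
      · exact Or.inl h0
      · exact Or.inr (Δ'.down_closed hs (Finset.filter_subset _ _) h0)
    · exact lift_mem_coneOn.mp (coneOn_mono Finset.inter_subset_right (hrF v hv))
    · exact ⟨a, fun v hv => (hrpos v hv).le, hrsum⟩

end Triangulation

lemma dimAddOne_eq {α : Type*} {K : PreAbstractSimplicialComplex α} {T : Finset (Finset α)}
    (hT : ∀ s, s ∈ T ↔ s = ∅ ∨ s ∈ K.faces) {d : ℕ} (hle : ∀ s ∈ T, s.card ≤ d)
    (hd : ∃ s ∈ T, s.card = d) : dimAddOne K = d := by
  obtain ⟨s, hs, rfl⟩ := hd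
  rw [dimAddOne]
  rcases (hT s).mp hs with rfl | hsK
  · have : Finset.card '' K.faces ⊆ {0} := by
      rintro _ ⟨t, ht, rfl⟩
      exact Nat.le_zero.mp (hle t ((hT t).mpr (Or.inr ht)))
    rcases Set.subset_singleton_iff_eq.mp this with h | h <;> simp [h]
  · refine IsGreatest.csSup_eq ⟨⟨s, hsK, rfl⟩, ?_⟩
    rintro _ ⟨t, ht, rfl⟩
    exact hle t ((hT t).mpr (Or.inr ht))

lemma hPoly_eq_sum {α : Type*} {K : PreAbstractSimplicialComplex α} {T : Finset (Finset α)}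
    (hT : ∀ s, s ∈ T ↔ s = ∅ ∨ s ∈ K.faces) {d : ℕ} (hle : ∀ s ∈ T, s.card ≤ d)
    (hd : ∃ s ∈ T, s.card = d) : hPoly K = ∑ s ∈ T, X ^ s.card * (1 - X) ^ (d - s.card) := by
  classical
  rw [hPoly, dimAddOne_eq hT hle hd, ← Finset.sum_fiberwise_of_maps_to
    (t := Finset.range (d + 1)) (g := Finset.card)
    (fun s hs => Finset.mem_range.mpr (Nat.lt_succ_of_le (hle s hs)))]
  refine Finset.sum_congr rfl fun i _ => ?_
  have hcount : faceNumber K i = (T.filter (·.card = i)).card := by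
    rw [faceNumber]
    split_ifs with hi
    · subst hi
      have : T.filter (·.card = 0) = {∅} := by
        ext s
        simp only [Finset.mem_filter, Finset.card_eq_zero, Finset.mem_singleton]
        exact ⟨fun h => h.2, fun h => ⟨(hT s).mpr (Or.inl h), h⟩⟩
      rw [this, Finset.card_singleton]
    · rw [← Set.ncard_coe_finset]
      congr 1
      ext s
      simp only [Set.mem_ofPred_eq, Finset.coe_filter, hT]
      refine and_congr_left fun hs => ⟨Or.inr, fun h => h.resolve_left ?_⟩
      rintro rfl
      exact hi (by simpa using hs.symm)
  rw [hcount, Finset.sum_congr rfl (g := fun _ => (X : ℝ[X]) ^ i * (1 - X) ^ (d - i))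
    (fun s hs => by rw [(Finset.mem_filter.mp hs).2]), Finset.sum_const, nsmul_eq_mul, mul_assoc]

/-- A triangulation with `γ`-positive local `h`-polynomials of a complex all of
whose links have `γ`-positive `h`-polynomials has a `γ`-positive `h`-polynomial. -/
theorem IsTriangulation.isGammaPositive_hPoly {E : Type*} [AddCommGroup E] [Module ℝ E]
    [DecidableEq E] {Δ Δ' : Geometry.SimplicialComplex ℝ E} (hΔ : IsTriangulation Δ' Δ)
    {D : Finset (Finset E)} (hD : ∀ s, s ∈ D ↔ s = ∅ ∨ s ∈ Δ.faces) {d : ℕ}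
    (hlinks : GammaLinks D d)
    (hlocal : ∀ F ∈ Δ.faces, IsGammaPositive (localHPoly Δ' F)) :
    IsGammaPositive (hPoly Δ'.toPreAbstractSimplicialComplex) := by
  classical
  obtain ⟨T, hT⟩ : ∃ T : Finset (Finset E), ∀ s, s ∈ T ↔ s = ∅ ∨ s ∈ Δ'.faces :=
    ⟨insert ∅ hΔ.1.toFinset, by simp⟩
  have hcar : ∀ s ∈ T, ∃ C ∈ D, ∀ F ∈ D, C ⊆ F ↔ (s : Set E) ⊆ convexHull ℝ (F : Set E) :=
    fun s hs => hΔ.exists_carrier hD ((hT s).mp hs)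
  choose! c hcD hc using hcar
  have hlower : ∀ F ∈ D, ∀ G ⊆ F, G ∈ D := by
    intro F hF G hGF
    rw [hD]
    rcases G.eq_empty_or_nonempty with h0 | h0
    · exact Or.inl h0
    · rcases (hD F).mp hF with rfl | hF
      · exact Or.inl (Finset.subset_empty.mp hGF)
      · exact Or.inr (Δ.down_closed hF hGF h0)
  have hmem : ∀ F ∈ D, ∀ s, s ∈ T.filter (c · ⊆ F) ↔
      (s = ∅ ∨ s ∈ Δ'.faces) ∧ (s : Set E) ⊆ convexHull ℝ (F : Set E) := by
    intro F hF s
    rw [Finset.mem_filter, ← hT]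
    exact and_congr_right fun hs => hc s hs F hF
  have hsub : ∀ F ∈ D, SubdividesCone lift (T.filter (c · ⊆ F)) F := fun F hF =>
    hΔ.subdividesCone ((hD F).mp hF) (hmem F hF)
  have hcard : ∀ s ∈ T, s.card ≤ (c s).card := fun s hs =>
    (hsub _ (hcD s hs)).card_le (Finset.mem_filter.mpr ⟨hs, Finset.Subset.refl _⟩)
  have hint : ∀ F ∈ D, ∀ s ∈ T.filter (c · ⊆ F),
      c s = F ↔ ∀ u ∈ F, ∃ v ∈ s, lift v ∉ coneOn lift (F.erase u) := by
    intro F hF s hs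
    obtain ⟨hsT, hsF⟩ := Finset.mem_filter.mp hs
    have hiff : ∀ u, (∀ v ∈ s, lift v ∈ coneOn lift (F.erase u)) ↔ c s ⊆ F.erase u := fun u => by
      rw [hc s hsT _ (hlower F hF _ (Finset.erase_subset u F))]
      exact forall₂_congr fun v _ => lift_mem_coneOn
    constructor
    · intro heq u hu
      by_contra! hcon
      have := (hiff u).mp hcon (heq ▸ hu)
      exact Finset.notMem_erase u F this
    · intro h
      refine Finset.Subset.antisymm hsF fun u hu => ?_
      by_contra hus
      obtain ⟨v, hv, hvu⟩ := h u hu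
      exact hvu ((hiff u).mpr (Finset.subset_erase.mpr ⟨hsF, hus⟩) v hv)
  have hstruct : ∀ F ∈ D, ∃ (M : Finset (Finset E)) (k : Finset E → ℕ),
      M ⊆ T.filter (c · ⊆ F) ∧ M.Nonempty ∧ (∀ t ∈ M, t.card = F.card ∧ k t ≤ F.card) ∧
      carriedPoly T c F = ∑ t ∈ M, X ^ k t ∧ interiorPoly T c F = ∑ t ∈ M, X ^ (F.card - k t) := by
    intro F hF
    have hfilter : T.filter (c · = F) = (T.filter (c · ⊆ F)).filter (c · = F) := by
      rw [Finset.filter_filter]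
      exact Finset.filter_congr fun s _ => ⟨fun h => ⟨h.subset, h⟩, And.right⟩
    rw [interiorPoly, hfilter]
    exact (hsub F hF).exists_hPoly_eq_sum ((hmem F hF ∅).mpr ⟨Or.inl rfl, by simp⟩) (c · = F)
      (hint F hF)
  have hrec : ∀ F ∈ D, ∀ x : ℝ, 0 < x →
      x ^ F.card * (carriedPoly T c F).eval x⁻¹ = (interiorPoly T c F).eval x := by
    intro F hF x hx
    obtain ⟨M, k, -, -, hk, h1, h2⟩ := hstruct F hF
    rw [h1, h2, eval_finsetSum, eval_finsetSum, Finset.mul_sum]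
    refine Finset.sum_congr rfl fun t ht => ?_
    rw [eval_pow, eval_pow, eval_X, eval_X, pow_sub₀ _ hx.ne' (hk t ht).2, inv_pow]
  have htop : ∀ F ∈ D, ∃ s ∈ T.filter (c · ⊆ F), s.card = F.card := by
    intro F hF
    obtain ⟨M, k, hM, ⟨t, ht⟩, hk, -⟩ := hstruct F hF
    exact ⟨t, hM ht, (hk t ht).1⟩
  have hcarried : ∀ F ∈ D, hPoly (faceRestriction Δ' F) = carriedPoly T c F := by
    intro F hF
    refine hPoly_eq_sum (fun s => ?_) (fun s hs => (hsub F hF).card_le hs) (htop F hF)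
    rw [hmem F hF]
    have hface : s ∈ (faceRestriction Δ' F).faces ↔
        s ∈ Δ'.faces ∧ (s : Set E) ⊆ convexHull ℝ (F : Set E) := Iff.rfl
    rw [hface, or_and_right]
    refine or_congr_left ⟨And.left, ?_⟩
    rintro rfl
    simp
  have hlocal' : ∀ F ∈ D, IsGammaPositive (localPoly T c F) := by
    intro F hF
    have heq : localHPoly Δ' F = localPoly T c F :=
      Finset.sum_congr rfl fun G hG => by
        rw [hcarried G (hlower F hF G (Finset.mem_powerset.mp hG))]
    rcases (hD F).mp hF with rfl | hF'
    · have h0 : T.filter (c · ⊆ ∅) = {∅} := by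
        ext s
        rw [hmem ∅ hF, Finset.mem_singleton]
        simp only [Finset.coe_empty, convexHull_empty, Set.subset_empty_iff, Finset.coe_eq_empty]
        exact ⟨And.right, fun h => ⟨Or.inl h, h⟩⟩
      have h1 : localPoly T c ∅ = 1 := by
        rw [localPoly, Finset.powerset_empty, Finset.sum_singleton, carriedPoly, h0]
        simp
      rw [h1]
      simpa using (GammaCentered.one_add_X_pow 0).isGammaPositive
    · rw [← heq]
      exact hlocal F hF'
  have hdim : ∃ s ∈ T, s.card = d := by
    obtain ⟨F, hF, rfl⟩ := hlinks.exists_card_eq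
    obtain ⟨s, hs, hsc⟩ := htop F hF
    exact ⟨s, (Finset.mem_filter.mp hs).1, hsc⟩
  rw [hPoly_eq_sum hT (fun s hs => (hcard s hs).trans (hlinks.card_le _ (hcD s hs))) hdim]
  exact (gammaCentered_of_localPoly hcard hcD hlower hlinks hrec hlocal').isGammaPositive

end GammaPos

end

theorem mainTheorem4 {E : Type*} [AddCommGroup E] [Module ℝ E]
    (Δ Δ' : Geometry.SimplicialComplex ℝ E)
    (hΔ : (∃ n : ℕ, GammaPos.IsRealization Δ (GammaPos.crossPolytopeBoundary n)) ∨
      (∃ n : ℕ, GammaPos.IsRealization Δ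
        (GammaPos.barycentricSubdivision (GammaPos.simplexBoundary (Fin (n + 1))))))
    (hΔ' : GammaPos.IsTriangulation Δ' Δ)
    (hlocal : ∀ F ∈ Δ.faces, GammaPos.IsGammaPositive (GammaPos.localHPoly Δ' F)) :
    GammaPos.IsGammaPositive (GammaPos.hPoly Δ'.toPreAbstractSimplicialComplex) := by
  classical
  rcases hΔ with ⟨n, hn⟩ | ⟨n, hn⟩
  · obtain ⟨D, hD, hlinks⟩ := hn.exists_gammaLinks (fun _ => GammaPos.mem_crossFaces)
      (GammaPos.gammaLinks_crossFaces n)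
    exact hΔ'.isGammaPositive_hPoly hD hlinks hlocal
  · obtain ⟨D, hD, hlinks⟩ := hn.exists_gammaLinks
      (fun _ => GammaPos.mem_chains_iff_barycentricSubdivision) (GammaPos.gammaLinks_chains n)
    exact hΔ'.isGammaPositive_hPoly hD hlinks hlocal
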